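/- **Superfast Tikhonov solver.** *Notions.* Let $r\ge 0$ and $\tau\in\mathbb Z^r$. The $\tau$-degree of $p\in\mathbb C[z]^r$ is $\max_i(\deg p_i-\tau_i)$, with $\deg 0=-\infty$. A basis of a submodule $S\subseteq\mathbb C[z]^r$ is a family $B^{(1)},\dots,B^{(k)}$ in $S$ such that each $p\in S$ is $\sum_j\alpha_jB^{(j)}$ with unique $\alpha_j\in\mathbb C[z]$. It is $\tau$-reduced if for all $\alpha_j$ the $\tau$-degree of $\sum_j\alpha_jB^{(j)}$ is $\max_j(\deg\alpha_j+\tau\text{-}\deg B^{(j)})$. Vectors $(\rho_0,\rho_1,\dots)$ are identified with polynomials $\sum_i\rho_iz^i$. Operations are: loading a constant, $+,-,\times,\div$, conjugation and zero test in $\mathbb C$ (exact arithmetic), and comparison of two integers. *Extension.* If $A=[a_{i-j}]$ is Toeplitz with $\mu$ rows and $\nu$ columns and $N\ge\mu+\nu-1$, let $c_N(A)$ be the vector with entries $a_{k-N+\mu}$, $0\le k<N$ (the $a_d$ with $d\le-\nu$ are arbitrary). The circulant matrix with first column $c_N(A)$ contains $A$ in its last $\mu$ rows and first $\nu$ columns.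 For $c\in\mathbb C^N$ let $\lambda^{(k)}(c)=\sum_jc_j\omega_k^j$ with $\omega_k=e^{2\pi ik/N}$; these are the eigenvalues of the circulant matrix with first column $c$. A row $(c_1,\dots,c_r)$ of vectors of $\mathbb C^N$ stands for the $N$ conditions $\sum_j\lambda^{(k)}(c_j)p_j(\omega_k)=0$, $0\le k<N$, on $p\in\mathbb C[z]^r$. Let $e_t$ denote the unit vectors, $t\ge0$. **(1) Recursive interleaved construction.** Let $N=2^e$, let $s\le 3$ conditions $\varphi\,p(\omega_k)=0$, $\varphi\in\mathbb C^{1\times r}$, be given at each node $\omega_k=e^{2\pi ik/N}$, and let $S\subseteq\mathbb C[z]^r$ be the submodule they define. Consider the following recursion. Construct a basis matrix $B_L$ for the nodes with even index. Replace each $\varphi$ at a node $\sigma$ of odd index by $\varphi B_L(\sigma)$, evaluating $B_L$ by FFT. Construct a basis matrix $B_R$ for these data with $\tau$ replaced by minus the $\tau$-degrees of the columns of $B_L$. Return $B_LB_R$, multiplied by FFT. At a single node the conditions are processed one after the other: if $B$ is the current matrix and $\varphi$ has been replaced by $\varphi B(\sigma)$, choose a column $a$ of least $\tau$-degree among those with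 $\varphi_a\ne0$, add $-\varphi_j/\varphi_a$ times column $a$ to each other column $j$, and multiply column $a$ by $z-\sigma$ (do nothing if $\varphi=0$). This recursion returns a $\tau$-reduced basis of $S$ together with its $\tau$-degrees. If $N\ge2$, it takes at most $K_r\,N\log^2N$ operations, where $K_r$ depends only on $r$. **(2) $T$ and $L$ Toeplitz.** Let $m,n,p\ge1$, let $T\in\mathbb C^{m\times n}$ and $L\in\mathbb C^{p\times n}$ be Toeplitz with $T^HT+L^HL$ invertible, let $b\in\mathbb C^m$, and let $\hat x=(T^HT+L^HL)^{-1}T^Hb$. Let $N_1\ge\max(m,p)+n-1$, $N_2\ge m+n-1$, $N_3\ge p+n-1$, and take any circulant extensions. Let $S\subseteq\mathbb C[z]^7$ be defined by the three rows $$\bigl(0,\ c_{N_1}(T^H),\ c_{N_1}(L^H),\ e_0,\ 0,\ 0,\ [0;-T^Hb]\bigr),$$ $$\bigl(-c_{N_2}(T),\ e_{N_2-m},\ 0,\ 0,\ e_0,\ 0,\ 0\bigr),$$ $$\bigl(-c_{N_3}(L),\ 0,\ e_{N_3-p},\ 0,\ 0,\ e_0,\ 0\bigr)$$ of vectors of length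 $N_1$, $N_2$, $N_3$ respectively, and let $\tau=(n-1,\,m-1,\,p-1,\,N_1-n-1,\,N_2-m-1,\,N_3-p-1,\,0)$. * There is $p^*\in S$ of $\tau$-degree $0$ with $p_1^*=\hat x$, $p_2^*=T\hat x$, $p_3^*=L\hat x$, $p_7^*=1$, and the elements of $S$ of $\tau$-degree at most $0$ are exactly the $\alpha p^*$, $\alpha\in\mathbb C$. * Every basis of $S$ has exactly $7$ elements, and $\tau$-reduced bases exist. In every $\tau$-reduced basis exactly one element $B^{(j)}$ has $\tau$-degree $0$ and the other six have $\tau$-degree $1$. Moreover $B^{(j)}_7$ is a nonzero constant and $\hat x(z)=B_1^{(j)}(z)/B_7^{(j)}$. * Take for $N_1=N_2=N_3$ the least power of two that is at least $\max(m,p)+n$, and zeros for the arbitrary entries. The algorithm that computes $T^Hb$ and the conditions by FFT from $b$ and the coefficients of $T$ and $L$, applies the recursion of (1), and divides the first component of the column of $\tau$-degree $0$ by its last component, constructs a $\tau$-reduced basis of $S$, returns $\hat x$, and takes at most $K\,N\log^2N$ operations. Here $N=(m+n-1)+(p+n-1)$ is the number of free parameters of $T$ and $L$, and $K$ is an absolute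 constant. **(3) $T^HT$ and $L$ Toeplitz.** Let $n,p\ge1$, let $T\in\mathbb C^{m\times n}$ be such that $G_T=T^HT$ is Toeplitz, let $L\in\mathbb C^{p\times n}$ be Toeplitz with $G_T+L^HL$ invertible, let $b\in\mathbb C^m$, and let $\hat x=(G_T+L^HL)^{-1}T^Hb$. The statements of (2) hold, with $5$ and four in place of $7$ and six, for $N_1\ge\max(n,p)+n-1$, $N_2\ge p+n-1$, the submodule $S\subseteq\mathbb C[z]^5$ defined by the rows $$\bigl(c_{N_1}(G_T),\ c_{N_1}(L^H),\ e_0,\ 0,\ [0;-T^Hb]\bigr),\qquad\bigl(-c_{N_2}(L),\ e_{N_2-p},\ 0,\ e_0,\ 0\bigr)$$ of vectors of length $N_1$ and $N_2$, $\tau=(n-1,\,p-1,\,N_1-n-1,\,N_2-p-1,\,0)$, and $p^*$ with $p_1^*=\hat x$, $p_2^*=L\hat x$, $p_5^*=1$. The algorithm is now given the coefficients of $G_T$ and $L$ and the vector $T^Hb$, uses the least power of two that is at least $\max(n,p)+n$, and takes at most $K\,N\log^2N$ operations with $N=n+(p+n-1)$. -/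

import Mathlib

open Polynomial

noncomputable section

namespace Tikhonov

/-! ## Vector polynomials, degrees shifted by `τ`, bases of submodules -/

/-- The polynomial `∑ ρ_i z^i` with coefficient vector `ρ`. -/
def toPoly {d : ℕ} (ρ : Fin d → ℂ) : ℂ[X] := ∑ i, C (ρ i) * X ^ (i : ℕ)

/-- The `τ`-degree `max_i (deg p_i - τ_i)`, with `deg 0 = -∞` (written `⊥`). -/
def tauDeg {r : ℕ} (τ : Fin r → ℤ) (p : Fin r → ℂ[X]) : WithBot ℤ :=
  Finset.univ.sup fun i => (p i).degree.map fun d : ℕ => (d : ℤ) - τ i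

/-- `B^(1), …, B^(k)` is a basis of `S`: the `B^(j)` lie in `S`, and each element of `S` is a
combination of them with unique polynomial coefficients. -/
def IsBasisOf {r k : ℕ} (S : Submodule ℂ[X] (Fin r → ℂ[X])) (B : Fin k → Fin r → ℂ[X]) : Prop :=
  (∀ j, B j ∈ S) ∧ ∀ p ∈ S, ∃! α : Fin k → ℂ[X], p = ∑ j, α j • B j

/-- Polynomial combinations of the `B^(j)` never lose `τ`-degree: the `τ`-degree of
`∑ α_j B^(j)` is the largest of the numbers `deg α_j + τ-deg B^(j)`. -/
def IsTauReduced {r k : ℕ} (τ : Fin r → ℤ) (B : Fin k → Fin r → ℂ[X]) : Prop :=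
  ∀ α : Fin k → ℂ[X], tauDeg τ (∑ j, α j • B j) =
    Finset.univ.sup fun j => (α j).degree.map (fun d : ℕ => (d : ℤ)) + tauDeg τ (B j)

/-- A basis of `S` that is `τ`-reduced. -/
def IsTauReducedBasis {r k : ℕ} (S : Submodule ℂ[X] (Fin r → ℂ[X])) (τ : Fin r → ℤ)
    (B : Fin k → Fin r → ℂ[X]) : Prop :=
  IsBasisOf S B ∧ IsTauReduced τ B

/-- The submodule of all vector polynomials `p` that satisfy the tangential-interpolation
conditions `φ_c p(σ_c) = 0`, for all `c`. -/
def interpModule {ι : Type} {r : ℕ} (σ : ι → ℂ) (φ : ι → Fin r → ℂ) :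
    Submodule ℂ[X] (Fin r → ℂ[X]) where
  carrier := {p | ∀ c, ∑ i, φ c i * (p i).eval (σ c) = 0}
  zero_mem' := by intro c; simp
  add_mem' := by
    intro p q hp hq c
    have h1 := hp c
    have h2 := hq c
    simp only [Pi.add_apply, eval_add, mul_add, Finset.sum_add_distrib, h1, h2, add_zero]
  smul_mem' := by
    intro a p hp c
    have h1 := hp c
    have h2 : ∀ i, φ c i * ((a • p) i).eval (σ c) =
        a.eval (σ c) * (φ c i * (p i).eval (σ c)) := by
      intro i
      simp only [Pi.smul_apply, smul_eq_mul, eval_mul]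
      ring
    simp only [h2, ← Finset.mul_sum, h1, mul_zero]

/-! ## Circulant extensions and the Fourier transform -/

/-- `ω_k = exp(2πik/N)`. -/
def node (N : ℕ) (k : Fin N) : ℂ := Complex.exp (2 * Real.pi * Complex.I * (k : ℕ) / N)

/-- The `N × N` Fourier matrix `(ω_k^j)`. -/
def fourier (N : ℕ) : Matrix (Fin N) (Fin N) ℂ := Matrix.of fun k j => node N k ^ (j : ℕ)

/-- First column of the `N × N` circulant matrix whose first columns are the circulant extension
of a Toeplitz matrix `[a_{i-j}]` with the given number of rows. The Toeplitz matrix occupies the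
last rows; the values `a_d` at diagonals `d` that do not occur in it are the arbitrary entries. -/
def circGen {V : Type} (N rows : ℕ) (a : ℤ → V) : Fin N → V :=
  fun k => a ((k : ℕ) - (N : ℤ) + rows)

/-- The symbol `a` with `z` in place of `a_d` for `d ≤ -cols`. -/
def truncSymbol {V : Type} (z : V) (cols : ℕ) (a : ℤ → V) : ℤ → V :=
  fun d => if -(cols : ℤ) < d then a d else z

/-- First column of the circulant matrix that starts with the columns of `[0; v]`. -/
def bottom {V : Type} (N : ℕ) {n : ℕ} (z : V) (v : Fin n → V) : Fin N → V :=
  fun k => if h : N - n ≤ (k : ℕ) then v ⟨(k : ℕ) - (N - n), by omega⟩ else z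

/-- The unit vector with its one in position `t` (counted from zero): the first column of the
circulant matrix that starts with the columns of `[0; I; 0]`, where `t` zero rows come first. -/
def unitVec {V : Type} (N t : ℕ) (z o : V) : Fin N → V := fun k => if (k : ℕ) = t then o else z

/-- If `C_j` is the circulant matrix with first column `c_j`, then `F C_j = Λ_j F` with
`Λ_j = diag (F c_j)`. Hence a block row `[C_1 … C_r]` of partial-circulant matrices becomes the
interpolation conditions `∑_j λ_j^(k) p_j(ω_k) = 0`, one for each `k`. -/
def blockRowModule (N : ℕ) {r : ℕ} (c : Fin r → Fin N → ℂ) : Submodule ℂ[X] (Fin r → ℂ[X]) :=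
  interpModule (node N) fun k j => (fourier N).mulVec (c j) k

/-- The diagonalization behind `blockRowModule`. -/
theorem fourier_mul_circulant (N : ℕ) (c : Fin N → ℂ) :
    fourier N * Matrix.circulant c = Matrix.diagonal ((fourier N).mulVec c) * fourier N := by
  rcases Nat.eq_zero_or_pos N with h0 | hpos
  · subst h0
    ext k
    exact k.elim0
  have : NeZero N := ⟨hpos.ne'⟩
  have hN : (N : ℂ) ≠ 0 := Nat.cast_ne_zero.mpr hpos.ne'
  have hw : ∀ k : Fin N, node N k ^ N = 1 := by
    intro k
    rw [node, ← Complex.exp_nat_mul, Complex.exp_eq_one_iff]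
    refine ⟨(k : ℕ), ?_⟩
    push_cast
    field_simp
  have hadd : ∀ k i j : Fin N,
      node N k ^ ((i + j : Fin N) : ℕ) = node N k ^ (i : ℕ) * node N k ^ (j : ℕ) := by
    intro k i j
    rw [Fin.val_add, ← pow_add]
    conv_rhs => rw [← Nat.div_add_mod ((i : ℕ) + j) N, pow_add, pow_mul, hw, one_pow, one_mul]
  ext k j
  rw [Matrix.diagonal_mul, Matrix.mul_apply, Matrix.mulVec, dotProduct, Finset.sum_mul,
    ← Equiv.sum_comp (Equiv.addRight j)]
  refine Finset.sum_congr rfl fun i _ => ?_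
  simp only [fourier, Matrix.of_apply, Matrix.circulant_apply, Equiv.coe_addRight,
    add_sub_cancel_right]
  rw [hadd]
  ring

/-- The Tikhonov solution `(TᴴT + LᴴL)⁻¹ Tᴴ b`. -/
def tikhonovSolution {m n p : ℕ} (T : Matrix (Fin m) (Fin n) ℂ) (L : Matrix (Fin p) (Fin n) ℂ)
    (b : Fin m → ℂ) : Fin n → ℂ :=
  (T.conjTranspose * T + L.conjTranspose * L)⁻¹.mulVec (T.conjTranspose.mulVec b)

/-! ## The interpolation problem for `(TᴴT + LᴴL) x = Tᴴb`

`T` is `m × n`, `L` is `p × n`; the three block rows have `N₁`, `N₂`, `N₃` rows. The unknowns are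
`x, σ₁ = T x, σ₂ = L x`, the variables `γ₁, γ₂, γ₃` that absorb the extension rows, and `1`. -/

/-- The vectors generating the circulant blocks of the first block row. -/
def generalRow₁ {V : Type} (N₁ : ℕ) (z o : V) (cTH cLH : Fin N₁ → V) (bhat : Fin N₁ → V) :
    Fin 7 → Fin N₁ → V :=
  ![fun _ => z, cTH, cLH, unitVec N₁ 0 z o, fun _ => z, fun _ => z, bhat]

/-- The vectors generating the circulant blocks of the second block row. -/
def generalRow₂ {V : Type} (N₂ m : ℕ) (z o : V) (cT : Fin N₂ → V) : Fin 7 → Fin N₂ → V :=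
  ![cT, unitVec N₂ (N₂ - m) z o, fun _ => z, fun _ => z, unitVec N₂ 0 z o, fun _ => z, fun _ => z]

/-- The vectors generating the circulant blocks of the third block row. -/
def generalRow₃ {V : Type} (N₃ p : ℕ) (z o : V) (cL : Fin N₃ → V) : Fin 7 → Fin N₃ → V :=
  ![cL, fun _ => z, unitVec N₃ (N₃ - p) z o, fun _ => z, fun _ => z, unitVec N₃ 0 z o, fun _ => z]

/-- The submodule `S ⊆ ℂ[z]⁷`. Here `aTH, aLH, aT, aL` are symbols of `Tᴴ, Lᴴ, T, L` (their
remaining values are the arbitrary entries of the extensions) and `y = Tᴴb`. -/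
def generalModule (m n p N₁ N₂ N₃ : ℕ) (aTH aLH aT aL : ℤ → ℂ) (y : Fin n → ℂ) :
    Submodule ℂ[X] (Fin 7 → ℂ[X]) :=
  blockRowModule N₁ (generalRow₁ N₁ 0 1 (circGen N₁ n aTH) (circGen N₁ n aLH) (bottom N₁ 0 (-y)))
  ⊓ blockRowModule N₂ (generalRow₂ N₂ m 0 1 (-circGen N₂ m aT))
  ⊓ blockRowModule N₃ (generalRow₃ N₃ p 0 1 (-circGen N₃ p aL))

/-- The shifts: one less than the length of each unknown. -/
def generalTau (m n p N₁ N₂ N₃ : ℕ) : Fin 7 → ℤ :=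
  ![n - 1, m - 1, p - 1, N₁ - n - 1, N₂ - m - 1, N₃ - p - 1, 0]

/-! ## The interpolation problem for `(G + LᴴL) x = y` with `G` Toeplitz

The unknowns are `x, σ = L x, γ₁, γ₂, 1`. -/

/-- The vectors generating the circulant blocks of the first block row. -/
def gramRow₁ {V : Type} (N₁ : ℕ) (z o : V) (cG cLH : Fin N₁ → V) (bhat : Fin N₁ → V) :
    Fin 5 → Fin N₁ → V :=
  ![cG, cLH, unitVec N₁ 0 z o, fun _ => z, bhat]

/-- The vectors generating the circulant blocks of the second block row. -/
def gramRow₂ {V : Type} (N₂ p : ℕ) (z o : V) (cL : Fin N₂ → V) : Fin 5 → Fin N₂ → V :=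
  ![cL, unitVec N₂ (N₂ - p) z o, fun _ => z, unitVec N₂ 0 z o, fun _ => z]

/-- The submodule `S ⊆ ℂ[z]⁵`. -/
def gramModule (n p N₁ N₂ : ℕ) (aG aLH aL : ℤ → ℂ) (y : Fin n → ℂ) :
    Submodule ℂ[X] (Fin 5 → ℂ[X]) :=
  blockRowModule N₁ (gramRow₁ N₁ 0 1 (circGen N₁ n aG) (circGen N₁ n aLH) (bottom N₁ 0 (-y)))
  ⊓ blockRowModule N₂ (gramRow₂ N₂ p 0 1 (-circGen N₂ p aL))

/-- The shifts: one less than the length of each unknown. -/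
def gramTau (n p N₁ N₂ : ℕ) : Fin 5 → ℤ :=
  ![n - 1, p - 1, N₁ - n - 1, N₂ - p - 1, 0]

/-- `x` can be read off every `τ`-reduced basis of `S`: all bases have `r + 1` elements, there are
`τ`-reduced ones, and in each of these exactly one element has `τ`-degree `0`, the others have
`τ`-degree `1`, and the first component of the exceptional element, divided by its last component
(a nonzero constant), is the polynomial of `x`. -/
def ReadOffBases {r n : ℕ} (S : Submodule ℂ[X] (Fin (r + 1) → ℂ[X])) (τ : Fin (r + 1) → ℤ)
    (x : Fin n → ℂ) : Prop :=
  (∀ (k : ℕ) (B : Fin k → Fin (r + 1) → ℂ[X]), IsBasisOf S B → k = r + 1) ∧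
  (∃ B : Fin (r + 1) → Fin (r + 1) → ℂ[X], IsTauReducedBasis S τ B) ∧
  (∀ B : Fin (r + 1) → Fin (r + 1) → ℂ[X], IsTauReducedBasis S τ B →
    ∃ j, tauDeg τ (B j) = 0 ∧ (∀ i, i ≠ j → tauDeg τ (B i) = 1) ∧
      ∃ β : ℂ, β ≠ 0 ∧ B j (Fin.last r) = C β ∧ toPoly x = C β⁻¹ * B j 0)

/-! ## Programs and their number of operations

A program may treat numbers (of the abstract type `V`) only through the listed instructions. Each
instruction counts as one operation; copying and addressing data is free. -/

/-- Programs over numbers of type `V` with result in `α`. -/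
inductive Prog (V : Type) (α : Type) : Type
  /-- stop and return a result -/
  | ret (a : α) : Prog V α
  /-- load a constant -/
  | const (c : ℂ) (k : V → Prog V α) : Prog V α
  | add (x y : V) (k : V → Prog V α) : Prog V α
  | sub (x y : V) (k : V → Prog V α) : Prog V α
  | mul (x y : V) (k : V → Prog V α) : Prog V α
  | div (x y : V) (k : V → Prog V α) : Prog V α
  /-- complex conjugation -/
  | conj (x : V) (k : V → Prog V α) : Prog V α
  /-- branch on whether a number is zero -/
  | isZero (x : V) (k : Bool → Prog V α) : Prog V α
  /-- branch on the outcome of one comparison of integers (used for `τ`-degrees) -/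
  | compare (b : Bool) (k : Bool → Prog V α) : Prog V α

namespace Prog

/-- Sequential composition. -/
def bind' {V α β : Type} : Prog V α → (α → Prog V β) → Prog V β
  | ret a, f => f a
  | const c k, f => const c fun v => bind' (k v) f
  | add x y k, f => add x y fun v => bind' (k v) f
  | sub x y k, f => sub x y fun v => bind' (k v) f
  | mul x y k, f => mul x y fun v => bind' (k v) f
  | div x y k, f => div x y fun v => bind' (k v) f
  | conj x k, f => conj x fun v => bind' (k v) f
  | isZero x k, f => isZero x fun v => bind' (k v) f
  | compare b k, f => compare b fun v => bind' (k v) f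

instance instMonadProg (V : Type) : Monad (Prog V) where
  pure := ret
  bind := bind'

/-- The result of a program on complex numbers. -/
def run {α : Type} : Prog ℂ α → α
  | ret a => a
  | const c k => run (k c)
  | add x y k => run (k (x + y))
  | sub x y k => run (k (x - y))
  | mul x y k => run (k (x * y))
  | div x y k => run (k (x / y))
  | conj x k => run (k (starRingEnd ℂ x))
  | isZero x k => open Classical in run (k (decide (x = 0)))
  | compare b k => run (k b)

/-- The number of operations that a program executes on complex numbers. -/
def cost {α : Type} : Prog ℂ α → ℕ
  | ret _ => 0
  | const c k => cost (k c) + 1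
  | add x y k => cost (k (x + y)) + 1
  | sub x y k => cost (k (x - y)) + 1
  | mul x y k => cost (k (x * y)) + 1
  | div x y k => cost (k (x / y)) + 1
  | conj x k => cost (k (starRingEnd ℂ x)) + 1
  | isZero x k => open Classical in cost (k (decide (x = 0))) + 1
  | compare b k => cost (k b) + 1

end Prog

section Instructions

variable {V : Type}

def constP (c : ℂ) : Prog V V := .const c .ret
def addP (x y : V) : Prog V V := .add x y .ret
def subP (x y : V) : Prog V V := .sub x y .ret
def mulP (x y : V) : Prog V V := .mul x y .ret
def divP (x y : V) : Prog V V := .div x y .ret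
def conjP (x : V) : Prog V V := .conj x .ret
def isZeroP (x : V) : Prog V Bool := .isZero x .ret
def compareP (b : Bool) : Prog V Bool := .compare b .ret

/-- Run the programs `f 0, f 1, …` one after the other and collect the results. -/
def tab {α : Type} : {n : ℕ} → (Fin n → Prog V α) → Prog V (Fin n → α)
  | 0, _ => pure Fin.elim0
  | _ + 1, f => do
    let x ← f 0
    let xs ← tab fun i => f i.succ
    pure (Fin.cons x xs)

/-- `∑ x_i`. -/
def sumP : {n : ℕ} → (Fin n → V) → Prog V V
  | 0, _ => constP 0
  | _ + 1, x => do
    let s ← sumP fun i => x i.succ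
    addP (x 0) s

/-- `∑ x_i y_i`. -/
def dotP {n : ℕ} (x y : Fin n → V) : Prog V V := do
  let t ← tab fun i => mulP (x i) (y i)
  sumP t

/-- `1, x, …, x^(n-1)`. -/
def powersP (x : V) : (n : ℕ) → Prog V (Fin n → V)
  | 0 => pure Fin.elim0
  | 1 => do
    let o ← constP 1
    pure fun _ => o
  | n + 2 => do
    let w ← powersP x (n + 1)
    let y ← mulP (w (Fin.last n)) x
    pure (Fin.snoc w y)

end Instructions

section FFT

variable {V : Type}

def evenIdx (e : ℕ) (k : Fin (2 ^ e)) : Fin (2 ^ (e + 1)) :=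
  ⟨2 * k, by have := k.isLt; rw [pow_succ]; omega⟩

def oddIdx (e : ℕ) (k : Fin (2 ^ e)) : Fin (2 ^ (e + 1)) :=
  ⟨2 * k + 1, by have := k.isLt; rw [pow_succ]; omega⟩

def modIdx (e : ℕ) (k : Fin (2 ^ (e + 1))) : Fin (2 ^ e) :=
  ⟨k % 2 ^ e, Nat.mod_lt _ (by positivity)⟩

/-- The index `i + t 2^e`. -/
def foldIdx (e : ℕ) (i : Fin (2 ^ e)) (t : Fin 4) : Fin (2 ^ (e + 2)) :=
  ⟨i + t * 2 ^ e, by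
    have h1 := i.isLt
    have h2 : (t : ℕ) ≤ 3 := by omega
    have h3 := Nat.mul_le_mul_right (2 ^ e) h2
    rw [pow_add]
    omega⟩

/-- Fast Fourier transform: `v ↦ (∑_j v_j ζ^(jk))_k`, for `ζ` of order `2^e`. -/
def fft : (e : ℕ) → (ζ : V) → (Fin (2 ^ e) → V) → Prog V (Fin (2 ^ e) → V)
  | 0, _, v => pure v
  | e + 1, ζ, v => do
    let ζ₂ ← mulP ζ ζ
    let E ← fft e ζ₂ fun k => v (evenIdx e k)
    let O ← fft e ζ₂ fun k => v (oddIdx e k)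
    let w ← powersP ζ (2 ^ (e + 1))
    tab fun k => do
      let t ← mulP (w k) (O (modIdx e k))
      addP (E (modIdx e k)) t

/-- Inverse fast Fourier transform. -/
def ifft (e : ℕ) (ζ : V) (v : Fin (2 ^ e) → V) : Prog V (Fin (2 ^ e) → V) := do
  let o ← constP 1
  let ζinv ← divP o ζ
  let w ← fft e ζinv v
  let N ← constP (2 ^ e)
  tab fun k => divP (w k) N

end FFT

section BasisConstruction

variable {V : Type}

/-- An `r × r` polynomial matrix, as entry-wise vectors of `d` coefficients. -/
abbrev PolyMat (V : Type) (r d : ℕ) : Type := Fin r → Fin r → Fin d → V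

/-- Among the indices `i` in the list with `φ_i ≠ 0` (and `best`), one with the largest `τ_i`. -/
def pivotP {r : ℕ} (φ : Fin r → V) (τ : Fin r → ℤ) :
    List (Fin r) → Option (Fin r) → Prog V (Option (Fin r))
  | [], best => pure best
  | i :: l, best => do
    let zero ← isZeroP (φ i)
    match zero, best with
    | true, _ => pivotP φ τ l best
    | false, none => pivotP φ τ l (some i)
    | false, some j => do
      let larger ← compareP (decide (τ j < τ i))
      pivotP φ τ l (if larger then some i else some j)

/-- Include one more condition `(σ, φ)` in a basis matrix `B` whose columns have `τ`-degrees
`-τ_j`: replace `φ` by `φ B(σ)`, choose the pivot column `a` of least `τ`-degree among those with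
`φ_a ≠ 0`, and multiply `B` by the matrix whose columns are `(z - σ) e_a` and `e_j + μ_j e_a`
(`j ≠ a`), where `μ_j = -φ_j / φ_a`. -/
def singlePoint {r : ℕ} (σ : V) (φ : Fin r → V) (st : PolyMat V r 4 × (Fin r → ℤ)) :
    Prog V (PolyMat V r 4 × (Fin r → ℤ)) := do
  let B := st.1
  let τ := st.2
  let z ← constP 0
  let w ← powersP σ 4
  let E ← tab fun i => tab fun j => dotP (B i j) w
  let φ ← tab fun j => dotP φ fun i => E i j
  let piv ← pivotP φ τ (List.finRange r) none
  match piv with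
  | none => pure (B, τ)
  | some a => do
    let μ ← tab fun j => do
      let t ← divP (φ j) (φ a)
      subP z t
    let B' ← tab fun i => tab fun j => tab fun k => do
      if j = a then do
        let t ← mulP σ (B i a k)
        subP (if k = 0 then z else B i a (k - 1)) t
      else do
        let t ← mulP (μ j) (B i a k)
        addP (B i j k) t
    pure (B', Function.update τ a (τ a - 1))

/-- Serial basis construction at one node `σ`, starting from the identity matrix. Polynomials of
degree at most `3` are enough for up to three conditions. -/
def tanInt {r : ℕ} (σ : V) (τ : Fin r → ℤ) :
    (t : ℕ) → (Fin t → Fin r → V) → Prog V (PolyMat V r 4 × (Fin r → ℤ))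
  | 0, _ => do
    let z ← constP 0
    let o ← constP 1
    pure (fun i j k => if i = j ∧ k = 0 then o else z, τ)
  | t + 1, φ => do
    let st ← tanInt σ τ t fun i => φ i.castSucc
    singlePoint σ (φ (Fin.last t)) st

/-- The values of a polynomial matrix at the points `y η^k`, for `η` of order `2^e`, each entry by
one Fourier transform of length `2^e`. -/
def evalMat {r : ℕ} (e : ℕ) (y η : V) (B : PolyMat V r (2 ^ (e + 2))) :
    Prog V (PolyMat V r (2 ^ e)) := do
  let w ← powersP y (2 ^ (e + 2))
  tab fun i => tab fun j => do
    let a ← tab fun k => dotP (fun t => B i j (foldIdx e k t)) fun t => w (foldIdx e k t)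
    fft e η a

/-- The coefficient vector, lengthened by zeros. -/
def padVec {d : ℕ} (d' : ℕ) (z : V) (v : Fin d → V) : Fin d' → V :=
  fun k => if h : (k : ℕ) < d then v ⟨k, h⟩ else z

/-- The product of two polynomial matrices by Fourier transforms of length `2^(e+3)`, for `θ` of
order `2^(e+3)`. -/
def mulMat {r : ℕ} (e : ℕ) (θ : V) (A B : PolyMat V r (2 ^ (e + 2))) :
    Prog V (PolyMat V r (2 ^ (e + 3))) := do
  let z ← constP 0
  let FA ← tab fun i => tab fun j => fft (e + 3) θ (padVec (2 ^ (e + 3)) z (A i j))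
  let FB ← tab fun i => tab fun j => fft (e + 3) θ (padVec (2 ^ (e + 3)) z (B i j))
  tab fun i => tab fun j => do
    let v ← tab fun k => dotP (fun l => FA i l k) fun l => FB l j k
    ifft (e + 3) θ v

/-- Recursive interleaved basis construction for the nodes `σ_k = c θ^(4k)`, `k < 2^e`, where `θ`
has order `2^(e+2)`, with `s` conditions `φ_k` at each node. It returns the basis matrix and the
negatives of the `τ`-degrees of its columns, which are the shifts for the next subproblem. -/
def recTanInt {r s : ℕ} : (e : ℕ) → (θ c : V) → (τ : Fin r → ℤ) →
    (Fin (2 ^ e) → Fin s → Fin r → V) → Prog V (PolyMat V r (2 ^ (e + 2)) × (Fin r → ℤ))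
  | 0, _, c, τ, φ => tanInt c τ s (φ 0)
  | e + 1, θ, c, τ, φ => do
    let θ₂ ← mulP θ θ
    let ζ ← mulP θ₂ θ₂
    let L ← recTanInt e θ₂ c τ fun k => φ (evenIdx e k)
    let y ← mulP c ζ
    let η ← mulP ζ ζ
    let E ← evalMat e y η L.1
    let φ' ← tab fun k => tab fun t => tab fun j => dotP (φ (oddIdx e k) t) fun i => E i j k
    let R ← recTanInt e θ₂ y L.2 φ'
    let B ← mulMat e θ L.1 R.1
    pure (B, R.2)

/-- The constant `exp(2πi/N)`. -/
def rootConst (N : ℕ) : Prog V V := constP (Complex.exp (2 * Real.pi * Complex.I / N))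

/-- The recursive construction for the nodes `ω_k`, `k < 2^e`. -/
def basisAtRoots {r s : ℕ} (e : ℕ) (τ : Fin r → ℤ) (φ : Fin (2 ^ e) → Fin s → Fin r → V) :
    Prog V (PolyMat V r (2 ^ (e + 2)) × (Fin r → ℤ)) := do
  let θ ← rootConst (2 ^ (e + 2))
  let o ← constP 1
  recTanInt e θ o τ φ

/-- A column whose `τ`-degree, as tracked by the construction, is zero. -/
def zeroColumn {r : ℕ} (τ : Fin r → ℤ) : List (Fin r) → Prog V (Option (Fin r))
  | [] => pure none
  | j :: l => do
    let found ← compareP (decide (τ j = 0))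
    if found then pure (some j) else zeroColumn τ l

/-- Read the solution off: the first component of the column of `τ`-degree zero, divided by the
last component of that column. -/
def readOff {r d : ℕ} (n : ℕ) (st : PolyMat V (r + 1) d × (Fin (r + 1) → ℤ)) :
    Prog V (Fin n → V) := do
  let z ← constP 0
  let j? ← zeroColumn st.2 (List.finRange (r + 1))
  match j? with
  | none => pure fun _ => z
  | some j => tab fun i => divP (padVec n z (st.1 0 j) i) (padVec 1 z (st.1 (Fin.last r) j) 0)

end BasisConstruction

section Solvers

variable {V : Type}

/-- The least `e` with `q + n ≤ 2^e`. -/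
def sizeExp (q n : ℕ) : ℕ := Nat.clog 2 (q + n)

/-- `-v` for a vector. -/
def negP {d : ℕ} (z : V) (v : Fin d → V) : Prog V (Fin d → V) := tab fun k => subP z (v k)

/-- The transformed block row: `(k, j) ↦ λ_j^(k)`. -/
def transformRow {r : ℕ} (e : ℕ) (ω : V) (c : Fin r → Fin (2 ^ e) → V) :
    Prog V (Fin r → Fin (2 ^ e) → V) := tab fun j => fft e ω (c j)

/-- The last `n` entries of the cyclic convolution of `c` and `v`. -/
def convBottom (e n : ℕ) (ω z : V) (c v : Fin (2 ^ e) → V) : Prog V (Fin n → V) := do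
  let fc ← fft e ω c
  let fv ← fft e ω v
  let f ← tab fun k => mulP (fc k) (fv k)
  let u ← ifft e ω f
  pure fun i => if h : 2 ^ e - n + (i : ℕ) < 2 ^ e then u ⟨2 ^ e - n + i, h⟩ else z

/-- The basis for the general problem, from the coefficients `a, l` of `T, L` and from `b`. All
block rows are extended to `2^e` rows, with zeros as arbitrary entries. -/
def generalBasis (m n p : ℕ) (a l : ℤ → V) (b : Fin m → V) :
    Prog V (PolyMat V 7 (2 ^ (sizeExp (max m p) n + 2)) × (Fin 7 → ℤ)) := do
  let e := sizeExp (max m p) n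
  let N := 2 ^ e
  let z ← constP 0
  let o ← constP 1
  let ω ← rootConst N
  let cTH ← tab fun k => conjP (circGen N n (truncSymbol z m fun d => a (-d)) k)
  let cLH ← tab fun k => conjP (circGen N n (truncSymbol z p fun d => l (-d)) k)
  let cT ← negP z (circGen N m (truncSymbol z n a))
  let cL ← negP z (circGen N p (truncSymbol z n l))
  let y ← convBottom e n ω z cTH (padVec N z b)
  let bhat ← negP z y
  let F ← transformRow e ω (generalRow₁ N z o cTH cLH (bottom N z bhat))
  let G ← transformRow e ω (generalRow₂ N m z o cT)
  let H ← transformRow e ω (generalRow₃ N p z o cL)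
  basisAtRoots e (generalTau m n p N N N) fun k => ![fun j => F j k, fun j => G j k, fun j => H j k]

/-- The basis for the Toeplitz-Gramian problem, from the coefficients `g, l` of `G, L` and from
the right-hand side `y`. -/
def gramBasis (n p : ℕ) (g l : ℤ → V) (y : Fin n → V) :
    Prog V (PolyMat V 5 (2 ^ (sizeExp (max n p) n + 2)) × (Fin 5 → ℤ)) := do
  let e := sizeExp (max n p) n
  let N := 2 ^ e
  let z ← constP 0
  let o ← constP 1
  let ω ← rootConst N
  let cLH ← tab fun k => conjP (circGen N n (truncSymbol z p fun d => l (-d)) k)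
  let cL ← negP z (circGen N p (truncSymbol z n l))
  let bhat ← negP z y
  let F ← transformRow e ω
    (gramRow₁ N z o (circGen N n (truncSymbol z n g)) cLH (bottom N z bhat))
  let G ← transformRow e ω (gramRow₂ N p z o cL)
  basisAtRoots e (gramTau n p N N) fun k => ![fun j => F j k, fun j => G j k]

/-- The solver for the general problem. -/
def generalSolver (m n p : ℕ) (a l : ℤ → V) (b : Fin m → V) : Prog V (Fin n → V) := do
  let st ← generalBasis m n p a l b
  readOff n st

/-- The solver for the Toeplitz-Gramian problem. -/
def gramSolver (n p : ℕ) (g l : ℤ → V) (y : Fin n → V) : Prog V (Fin n → V) := do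
  let st ← gramBasis n p g l y
  readOff n st

end Solvers

/-- The columns of a polynomial matrix given by coefficients. -/
def columns {r d : ℕ} (B : PolyMat ℂ r d) : Fin r → Fin r → ℂ[X] := fun j i => toPoly (B i j)

/-- `st = (B, τ')` is a `τ`-reduced basis matrix of `S` with column degrees `-τ'`. -/
def IsReducedOutput {r d : ℕ} (S : Submodule ℂ[X] (Fin r → ℂ[X])) (τ : Fin r → ℤ)
    (st : PolyMat ℂ r d × (Fin r → ℤ)) : Prop :=
  IsTauReducedBasis S τ (columns st.1) ∧ ∀ j, tauDeg τ (columns st.1 j) = ((-st.2 j : ℤ) : WithBot ℤ)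

end Tikhonov

end

/-! Everything rests on square polynomial matrices B for which α ↦ Bα maps ℂ[z]^r onto S and turns
τ'-degrees into τ-degrees (`IsReducedMatrix`). Preservation of degrees forces injectivity, so the
columns form a τ-reduced basis whose j-th element has τ-degree -τ'_j. Such maps compose
(`IsReducedMatrix.comp`): once B solves some conditions, the remaining ones are pulled back along B,
φ becoming φB(σ) and τ becoming τ'. One condition is solved by `isReducedMatrix_pivotColumns`;
choosing the pivot of least τ-degree keeps the degrees under control. Serial and recursive
construction are both iterated composition. Merging two halves by Fourier transforms costs O((e+1)
2^e), so the recursion costs O((e+1)² 2^e).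

For the Tikhonov problems, the Fourier matrix is injective and diagonalizes circulants. For vectors
within the degree bounds the interpolation conditions are therefore a circulant linear system
(`mem_blockRowModule_iff`). Its last rows are the Toeplitz equations and its first rows merely
determine the γ's. Eliminating σ₁ = Tx and σ₂ = Lx leaves (TᴴT + LᴴL)x = βTᴴb, so invertibility
makes the elements of τ-degree at most 0 a line ℂp*.

Let there be r + 1 components (`readOffBases_interpModule`). In a τ-reduced basis nothing cancels,
so one basis element is a multiple of p* and all others have τ-degree at least 1. They have τ-degree
exactly 1 by a dimension count: the elements of S of τ-degree at most 1 form a space of dimension at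
least Σ(τ_i + 2) minus the number of conditions, which is at least r + 2, whereas a basis element of
τ-degree 2 or more would leave only r + 1 generators for it. The solver finds the exceptional column
through the tracked degrees, and the transform length is less than twice the number of free
parameters. -/

noncomputable section

namespace Tikhonov

/-! ## Results and costs of the basic programs -/

namespace Prog

variable {α β : Type}

@[simp] theorem run_pure (a : α) : (pure a : Prog ℂ α).run = a := rfl

@[simp] theorem cost_pure (a : α) : (pure a : Prog ℂ α).cost = 0 := rfl

@[simp] theorem run_bind (x : Prog ℂ α) (f : α → Prog ℂ β) :
    (x >>= f).run = (f x.run).run := by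
  change (bind' x f).run = _
  induction x with
  | ret a => rfl
  | _ => rename_i ih; simp only [bind', run, ih]

@[simp] theorem cost_bind (x : Prog ℂ α) (f : α → Prog ℂ β) :
    (x >>= f).cost = x.cost + (f x.run).cost := by
  change (bind' x f).cost = _
  induction x with
  | ret a => simp [bind', run, cost]
  | _ => rename_i ih; simp only [bind', run, cost, ih]; omega

/-- The continuation is bounded for every `y`, so cost estimates never have to mention intermediate
results. -/
theorem cost_bind_le {x : Prog ℂ α} {f : α → Prog ℂ β} {a b : ℕ} (hx : x.cost ≤ a)
    (hf : ∀ y, (f y).cost ≤ b) : (x >>= f).cost ≤ a + b := by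
  rw [cost_bind]
  exact add_le_add hx (hf _)

end Prog

section Instructions

open Prog

@[simp] theorem run_constP (c : ℂ) : (constP c : Prog ℂ ℂ).run = c := rfl
@[simp] theorem run_addP (x y : ℂ) : (addP x y).run = x + y := rfl
@[simp] theorem run_subP (x y : ℂ) : (subP x y).run = x - y := rfl
@[simp] theorem run_mulP (x y : ℂ) : (mulP x y).run = x * y := rfl
@[simp] theorem run_divP (x y : ℂ) : (divP x y).run = x / y := rfl
@[simp] theorem run_conjP (x : ℂ) : (conjP x).run = starRingEnd ℂ x := rfl
@[simp] theorem run_isZeroP (x : ℂ) :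
    (isZeroP x).run = open Classical in decide (x = 0) := rfl
@[simp] theorem run_compareP (b : Bool) : (compareP b : Prog ℂ Bool).run = b := rfl
@[simp] theorem run_rootConst (N : ℕ) :
    (rootConst N : Prog ℂ ℂ).run = Complex.exp (2 * Real.pi * Complex.I / N) := rfl

@[simp] theorem cost_constP (c : ℂ) : (constP c : Prog ℂ ℂ).cost = 1 := rfl
@[simp] theorem cost_addP (x y : ℂ) : (addP x y).cost = 1 := rfl
@[simp] theorem cost_subP (x y : ℂ) : (subP x y).cost = 1 := rfl
@[simp] theorem cost_mulP (x y : ℂ) : (mulP x y).cost = 1 := rfl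
@[simp] theorem cost_divP (x y : ℂ) : (divP x y).cost = 1 := rfl
@[simp] theorem cost_conjP (x : ℂ) : (conjP x).cost = 1 := rfl
@[simp] theorem cost_isZeroP (x : ℂ) : (isZeroP x).cost = 1 := rfl
@[simp] theorem cost_compareP (b : Bool) : (compareP b : Prog ℂ Bool).cost = 1 := rfl
@[simp] theorem cost_rootConst (N : ℕ) : (rootConst N : Prog ℂ ℂ).cost = 1 := rfl

@[simp] theorem run_tab {α : Type} {n : ℕ} (f : Fin n → Prog ℂ α) :
    (tab f).run = fun i => (f i).run := by
  induction n with
  | zero => funext i; exact i.elim0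
  | succ n ih =>
    funext i
    simp only [tab, run_bind, run_pure, ih]
    refine Fin.cases ?_ (fun j => ?_) i <;> simp

theorem cost_tab_le {α : Type} {n c : ℕ} {f : Fin n → Prog ℂ α} (h : ∀ i, (f i).cost ≤ c) :
    (tab f).cost ≤ n * c := by
  induction n with
  | zero => simp [tab]
  | succ n ih =>
    simp only [tab, cost_bind, cost_pure]
    have := ih fun i => h i.succ
    have := h 0
    rw [Nat.succ_mul]
    omega

@[simp] theorem run_sumP {n : ℕ} (x : Fin n → ℂ) : (sumP x).run = ∑ i, x i := by
  induction n with
  | zero => simp [sumP]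
  | succ n ih => simp [sumP, ih, Fin.sum_univ_succ]

@[simp] theorem cost_sumP {n : ℕ} (x : Fin n → ℂ) : (sumP x).cost = n + 1 := by
  induction n with
  | zero => simp [sumP]
  | succ n ih => simp [sumP, ih]

@[simp] theorem run_dotP {n : ℕ} (x y : Fin n → ℂ) : (dotP x y).run = ∑ i, x i * y i := by
  simp [dotP]

theorem cost_dotP_le {n : ℕ} (x y : Fin n → ℂ) : (dotP x y).cost ≤ 2 * n + 1 := by
  refine (cost_bind_le (cost_tab_le (c := 1) fun i => by simp)
    fun t => (cost_sumP t).le).trans (by omega)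

@[simp] theorem run_powersP (x : ℂ) (n : ℕ) :
    (powersP x n).run = fun i : Fin n => x ^ (i : ℕ) := by
  induction n with
  | zero => funext i; exact i.elim0
  | succ n ih =>
    cases n with
    | zero =>
      funext i
      have : i = 0 := Subsingleton.elim (α := Fin 1) i 0
      simp [powersP, this]
    | succ n =>
      funext i
      simp only [powersP, run_bind, ih, run_mulP, run_pure]
      refine Fin.lastCases ?_ (fun j => ?_) i
      · simp [pow_succ]
      · simp

theorem cost_powersP (x : ℂ) (n : ℕ) : (powersP x n).cost = n := by
  induction n with
  | zero => simp [powersP]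
  | succ n ih =>
    cases n with
    | zero => simp [powersP]
    | succ n => simp [powersP, ih]

end Instructions

/-! ### The fast Fourier transform and its inverse -/

section FFT

open Prog

theorem sum_even_odd {M : Type*} [AddCommMonoid M] (e : ℕ) (f : Fin (2 ^ (e + 1)) → M) :
    ∑ k, f k = (∑ k, f (evenIdx e k)) + ∑ k, f (oddIdx e k) := by
  have h : 2 ^ (e + 1) = 2 ^ e * 2 := pow_succ 2 e
  rw [← (finCongr h.symm).sum_comp, ← finProdFinEquiv.sum_comp, Fintype.sum_prod_type,
    ← Finset.sum_add_distrib]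
  refine Finset.sum_congr rfl fun k _ => ?_
  rw [Fin.sum_univ_two]
  congr 2 <;> ext <;> simp [evenIdx, oddIdx, finProdFinEquiv]; omega

/-- Radix-two splitting: both halves are transforms for ζ², whose powers (ζ²)^(jk) depend on k only
modulo 2^e. Primitivity of ζ plays no role here; it matters only for inversion. -/
theorem run_fft (e : ℕ) (ζ : ℂ) (hζ : ζ ^ 2 ^ e = 1) (v : Fin (2 ^ e) → ℂ) :
    (fft e ζ v).run = fun k : Fin (2 ^ e) => ∑ j, v j * ζ ^ ((j : ℕ) * (k : ℕ)) := by
  induction e generalizing ζ with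
  | zero =>
    funext k
    have : k = 0 := Subsingleton.elim (α := Fin 1) k 0
    subst this
    change v 0 = ∑ j : Fin 1, _
    simp
  | succ e ih =>
    have h2 : (ζ * ζ) ^ 2 ^ e = 1 := by
      rw [← hζ, ← pow_two, ← pow_mul, pow_succ, mul_comm]
    have hmod : ∀ (j : ℕ) (k : Fin (2 ^ (e + 1))),
        (ζ * ζ) ^ (j * (modIdx e k : ℕ)) = ζ ^ (2 * j * k) := by
      intro j k
      rw [show ζ ^ (2 * j * k) = (ζ * ζ) ^ (j * (k : ℕ)) by
        rw [← pow_two, ← pow_mul, mul_assoc], mul_comm j, mul_comm j, pow_mul, pow_mul]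
      congr 1
      conv_rhs => rw [← Nat.mod_add_div (k : ℕ) (2 ^ e), pow_add, pow_mul, h2, one_pow, mul_one]
      rfl
    funext k
    simp only [fft, run_bind, run_mulP, run_tab, run_powersP, run_addP, ih _ h2, hmod]
    rw [sum_even_odd, Finset.mul_sum]
    congr 1
    refine Finset.sum_congr rfl fun j _ => ?_
    rw [mul_left_comm, ← pow_add]
    congr 2
    simp only [oddIdx]
    ring

/-- A level costs one squaring, 2^(e+1) operations for the powers and twice as many for the
combinations, together at most 4 · 2^(e+1). -/
theorem cost_fft_le (e : ℕ) (ζ : ℂ) (v : Fin (2 ^ e) → ℂ) :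
    (fft e ζ v).cost ≤ 4 * e * 2 ^ e := by
  induction e generalizing ζ with
  | zero => simp [fft]
  | succ e ih =>
    rw [fft]
    refine (cost_bind_le (cost_mulP _ _).le fun _ => cost_bind_le (ih _ _) fun _ =>
      cost_bind_le (ih _ _) fun _ => cost_bind_le (cost_powersP _ _).le fun _ =>
      cost_tab_le (c := 2) fun i => by simp).trans ?_
    have : 1 ≤ 2 ^ e := Nat.one_le_two_pow
    rw [pow_succ]
    nlinarith

/-- Orthogonality of characters: off the diagonal this is a full geometric sum whose ratio is an
N-th root of unity other than 1. -/
theorem sum_pow_eq_ite {N : ℕ} {ζ : ℂ} (hζ : IsPrimitiveRoot ζ N) (j l : Fin N) :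
    ∑ k : Fin N, ζ ^ ((j : ℕ) * k) * ζ⁻¹ ^ ((k : ℕ) * l) = if j = l then (N : ℂ) else 0 := by
  have hN : 0 < N := j.pos
  have h0 : ζ ≠ 0 := hζ.ne_zero hN.ne'
  have h1 : ∀ k : Fin N, ζ ^ ((j : ℕ) * k) * ζ⁻¹ ^ ((k : ℕ) * l) =
      (ζ ^ (j : ℕ) * ζ⁻¹ ^ (l : ℕ)) ^ (k : ℕ) := fun k => by
    rw [mul_pow, pow_mul, mul_comm (k : ℕ), pow_mul]
  simp only [h1]
  rw [Fin.sum_univ_eq_sum_range fun k => (ζ ^ (j : ℕ) * ζ⁻¹ ^ (l : ℕ)) ^ k]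
  split_ifs with h
  · subst h
    simp [inv_pow, mul_inv_cancel₀ (pow_ne_zero _ h0)]
  · have hne : ζ ^ (j : ℕ) * ζ⁻¹ ^ (l : ℕ) ≠ 1 := by
      intro hc
      apply h
      rw [inv_pow, mul_inv_eq_one₀ (pow_ne_zero _ h0)] at hc
      exact Fin.ext (hζ.pow_inj j.2 l.2 hc)
    have := geom_sum_eq hne N
    rw [this, mul_pow, ← pow_mul, ← pow_mul, mul_comm (j : ℕ), mul_comm (l : ℕ), pow_mul,
      pow_mul, inv_pow, hζ.pow_eq_one]
    simp

/-- The expected answer `u` is supplied in advance, so each use reduces to checking its forward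
transform. -/
theorem run_ifft {e : ℕ} {ζ : ℂ} (hζ : IsPrimitiveRoot ζ (2 ^ e)) {u v : Fin (2 ^ e) → ℂ}
    (h : ∀ k, v k = ∑ j, u j * ζ ^ ((j : ℕ) * (k : ℕ))) : (ifft e ζ v).run = u := by
  funext l
  have hinv : (1 / ζ) ^ 2 ^ e = 1 := by rw [div_pow, hζ.pow_eq_one]; simp
  simp only [ifft, run_bind, run_constP, run_divP, run_tab, run_fft e _ hinv, h]
  simp only [one_div, Finset.sum_mul, mul_assoc]
  rw [Finset.sum_comm]
  simp only [← Finset.mul_sum, sum_pow_eq_ite hζ]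
  simp

theorem cost_ifft_le (e : ℕ) (ζ : ℂ) (v : Fin (2 ^ e) → ℂ) :
    (ifft e ζ v).cost ≤ (4 * e + 4) * 2 ^ e := by
  rw [ifft]
  refine (cost_bind_le (cost_constP _).le fun _ => cost_bind_le (cost_divP _ _).le fun _ =>
    cost_bind_le (cost_fft_le _ _ _) fun _ => cost_bind_le (cost_constP _).le fun _ =>
    cost_tab_le (c := 1) fun i => by simp).trans ?_
  have : 1 ≤ 2 ^ e := Nat.one_le_two_pow
  nlinarith

end FFT

/-! ## Shifted degrees and reduced basis matrices -/

/-- The polynomials of degree at most the integer `t`. -/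
def degLE (t : ℤ) : Submodule ℂ ℂ[X] where
  carrier := {p | ∀ k : ℕ, t < k → p.coeff k = 0}
  zero_mem' := by intro k _; simp
  add_mem' := by intro p q hp hq k hk; simp [hp k hk, hq k hk]
  smul_mem' := by intro c p hp k hk; simp [hp k hk]

theorem mem_degLE {t : ℤ} {p : ℂ[X]} : p ∈ degLE t ↔ ∀ k : ℕ, t < k → p.coeff k = 0 := Iff.rfl

theorem mem_degLE_iff {t : ℤ} {p : ℂ[X]} : p ∈ degLE t ↔ p = 0 ∨ (p.natDegree : ℤ) ≤ t := by
  constructor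
  · intro h
    by_contra! hc
    exact hc.1 (leadingCoeff_eq_zero.mp (h _ hc.2))
  · rintro (rfl | h) k hk
    · simp
    · exact coeff_eq_zero_of_natDegree_lt (by omega)

theorem degree_map_le_iff {t s : ℤ} {p : ℂ[X]} :
    (p.degree.map fun d : ℕ => (d : ℤ) - s) ≤ (t : WithBot ℤ) ↔ p ∈ degLE (t + s) := by
  rw [mem_degLE_iff]
  by_cases hp : p = 0
  · simp [hp]
  · rw [degree_eq_natDegree hp]
    have : (((p.natDegree : ℕ) : WithBot ℕ).map fun d : ℕ => (d : ℤ) - s) =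
      ((p.natDegree - s : ℤ) : WithBot ℤ) := rfl
    rw [this, WithBot.coe_le_coe]
    simp [hp]

theorem mul_mem_degLE {t s : ℤ} {p q : ℂ[X]} (hp : p ∈ degLE t) (hq : q ∈ degLE s) :
    p * q ∈ degLE (t + s) := by
  rw [mem_degLE_iff] at *
  rcases hp with rfl | hp
  · simp
  rcases hq with rfl | hq
  · simp
  have := natDegree_mul_le (p := p) (q := q)
  right
  omega

theorem C_mem_degLE_zero (c : ℂ) : C c ∈ degLE 0 := by
  rw [mem_degLE_iff]
  simp

theorem degLE_mono {s t : ℤ} (h : s ≤ t) : degLE s ≤ degLE t :=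
  fun _ hp k hk => hp k (h.trans_lt hk)

theorem X_sub_C_mul_mem_degLE {t : ℤ} {σ : ℂ} {p : ℂ[X]} :
    (X - C σ) * p ∈ degLE t ↔ p ∈ degLE (t - 1) := by
  rw [mem_degLE_iff, mem_degLE_iff]
  by_cases hp : p = 0
  · simp [hp]
  · rw [natDegree_mul (X_sub_C_ne_zero σ) hp, natDegree_X_sub_C]
    simp only [mul_eq_zero, hp, X_sub_C_ne_zero, false_or]
    push_cast
    omega

/-- Degree arguments are carried out in the subspaces `degLE`, where closure under sums is
available, instead of with maxima in `WithBot ℤ`. -/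
theorem tauDeg_le_iff {r : ℕ} {τ : Fin r → ℤ} {p : Fin r → ℂ[X]} {d : ℤ} :
    tauDeg τ p ≤ (d : WithBot ℤ) ↔ ∀ i, p i ∈ degLE (d + τ i) := by
  simp only [tauDeg, Finset.sup_le_iff, Finset.mem_univ, true_imp_iff, degree_map_le_iff]

/-- Integers suffice as test values: `⊥` is separated from `b` by `b - 1`. -/
theorem withBot_eq_of_forall_le_iff {a b : WithBot ℤ}
    (h : ∀ d : ℤ, a ≤ (d : WithBot ℤ) ↔ b ≤ (d : WithBot ℤ)) : a = b := by
  induction a with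
  | bot =>
    induction b with
    | bot => rfl
    | coe b =>
      have := (h (b - 1)).mp bot_le
      rw [WithBot.coe_le_coe] at this
      omega
  | coe a =>
    induction b with
    | bot =>
      have := (h (a - 1)).mpr bot_le
      rw [WithBot.coe_le_coe] at this
      omega
    | coe b => exact le_antisymm ((h b).mpr le_rfl) ((h a).mp le_rfl)

theorem tauDeg_eq_bot_iff {r : ℕ} {τ : Fin r → ℤ} {p : Fin r → ℂ[X]} :
    tauDeg τ p = ⊥ ↔ p = 0 := by
  simp only [tauDeg, Finset.sup_eq_bot_iff, Finset.mem_univ, true_imp_iff, WithBot.map_eq_bot_iff,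
    degree_eq_bot, funext_iff, Pi.zero_apply]

/-- The polynomial combination `∑ α_j B^(j)`. -/
def comb {r k : ℕ} (B : Fin k → Fin r → ℂ[X]) (α : Fin k → ℂ[X]) : Fin r → ℂ[X] :=
  ∑ j, α j • B j

theorem comb_apply {r k : ℕ} (B : Fin k → Fin r → ℂ[X]) (α : Fin k → ℂ[X]) (i : Fin r) :
    comb B α i = ∑ j, α j * B j i := by
  simp [comb, Finset.sum_apply]

theorem comb_sub {r k : ℕ} (B : Fin k → Fin r → ℂ[X]) (α β : Fin k → ℂ[X]) :
    comb B (α - β) = comb B α - comb B β := by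
  simp [comb, sub_smul]

theorem comb_single {r k : ℕ} (B : Fin k → Fin r → ℂ[X]) (j : Fin k) (c : ℂ[X]) :
    comb B (Pi.single j c) = c • B j := by
  rw [comb, Finset.sum_eq_single j] <;> simp +contextual

/-- Associativity of matrix multiplication, with the columns of a product AB written as A applied to
the columns of B. -/
theorem comb_comb {r k l : ℕ} (A : Fin k → Fin r → ℂ[X]) (B : Fin l → Fin k → ℂ[X])
    (α : Fin l → ℂ[X]) : comb (fun j => comb A (B j)) α = comb A (comb B α) := by
  ext1 i
  simp only [comb_apply, Finset.mul_sum, Finset.sum_mul]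
  rw [Finset.sum_comm]
  simp only [mul_assoc]

/-- The columns of `B` generate `S`, and combining them turns `τ'`-degrees into `τ`-degrees. -/
structure IsReducedMatrix {r : ℕ} (S : Set (Fin r → ℂ[X])) (τ τ' : Fin r → ℤ)
    (B : Fin r → Fin r → ℂ[X]) : Prop where
  mem_iff : ∀ p, p ∈ S ↔ ∃ α, p = comb B α
  tauDeg_comb : ∀ α, tauDeg τ (comb B α) = tauDeg τ' α

namespace IsReducedMatrix

variable {r : ℕ} {S : Set (Fin r → ℂ[X])} {τ τ' : Fin r → ℤ} {B : Fin r → Fin r → ℂ[X]}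

/-- Degree -∞ characterizes zero on both sides, so preservation of degrees leaves no kernel. -/
theorem comb_injective (h : IsReducedMatrix S τ τ' B) : Function.Injective (comb B) := by
  intro α β hαβ
  rw [← sub_eq_zero, ← tauDeg_eq_bot_iff (τ := τ'), ← h.tauDeg_comb, comb_sub, hαβ, sub_self,
    tauDeg_eq_bot_iff]

theorem one (τ : Fin r → ℤ) :
    IsReducedMatrix Set.univ τ τ (fun j => Pi.single j 1) := by
  have : ∀ α : Fin r → ℂ[X], comb (fun j => Pi.single j 1) α = α := by
    intro α
    ext1 i
    simp [comb_apply, Pi.single_apply]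
  exact ⟨fun p => by simp [this], fun α => by rw [this]⟩

/-- The correctness principle of both the serial and the recursive construction: the second factor
only has to treat the pulled-back conditions, with the shifts that the first factor left behind. -/
theorem comp {S' : Set (Fin r → ℂ[X])} {τ'' : Fin r → ℤ} {E : Fin r → Fin r → ℂ[X]}
    (h : IsReducedMatrix S τ τ' B) (hE : IsReducedMatrix {α | comb B α ∈ S'} τ' τ'' E) :
    IsReducedMatrix (S ∩ S') τ τ'' (fun j => comb B (E j)) := by
  refine ⟨fun p => ?_, fun α => by rw [comb_comb, h.tauDeg_comb, hE.tauDeg_comb]⟩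
  simp only [comb_comb, Set.mem_inter_iff, h.mem_iff]
  constructor
  · rintro ⟨⟨α, rfl⟩, hα⟩
    obtain ⟨β, rfl⟩ := (hE.mem_iff α).mp hα
    exact ⟨β, rfl⟩
  · rintro ⟨β, rfl⟩
    exact ⟨⟨_, rfl⟩, (hE.mem_iff _).mpr ⟨β, rfl⟩⟩

/-- Column j is the image of the j-th unit vector, whose τ'-degree is -τ'_j. -/
theorem tauDeg_column (h : IsReducedMatrix S τ τ' B) (j : Fin r) :
    tauDeg τ (B j) = ((-τ' j : ℤ) : WithBot ℤ) := by
  have h1 := h.tauDeg_comb (Pi.single j 1)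
  rw [comb_single, one_smul] at h1
  rw [h1]
  refine withBot_eq_of_forall_le_iff fun d => ?_
  rw [tauDeg_le_iff, WithBot.coe_le_coe]
  constructor
  · intro hd
    have := hd j
    rw [Pi.single_eq_same, mem_degLE_iff] at this
    simp at this
    omega
  · intro hd i
    by_cases hi : i = j
    · subst hi
      rw [Pi.single_eq_same, mem_degLE_iff]
      right
      simp
      omega
    · rw [Pi.single_eq_of_ne hi]
      exact zero_mem _

theorem isTauReducedBasis {S : Submodule ℂ[X] (Fin r → ℂ[X])}
    (h : IsReducedMatrix (S : Set (Fin r → ℂ[X])) τ τ' B) : IsTauReducedBasis S τ B := by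
  refine ⟨⟨fun j => ?_, fun p hp => ?_⟩, fun α => ?_⟩
  · exact (h.mem_iff _).mpr ⟨Pi.single j 1, by rw [comb_single, one_smul]⟩
  · obtain ⟨α, hα⟩ := (h.mem_iff p).mp hp
    exact ⟨α, hα, fun β hβ => h.comb_injective (hβ.symm.trans hα)⟩
  · refine (h.tauDeg_comb α).trans ?_
    rw [tauDeg]
    congr 1
    funext j
    rw [h.tauDeg_column]
    cases (α j).degree with
    | bot => simp
    | coe d => rfl

end IsReducedMatrix

/-! ### One interpolation condition and its elimination by a pivot -/

/-- The vector polynomials that satisfy the single condition `φ p(σ) = 0`. -/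
def condSet {r : ℕ} (σ : ℂ) (φ : Fin r → ℂ) : Set (Fin r → ℂ[X]) :=
  {p | ∑ i, φ i * (p i).eval σ = 0}

/-- This justifies the replacement of φ by φB(σ) in the algorithm. -/
theorem comb_mem_condSet {r : ℕ} {σ : ℂ} {φ : Fin r → ℂ} (B : Fin r → Fin r → ℂ[X])
    (α : Fin r → ℂ[X]) :
    comb B α ∈ condSet σ φ ↔ α ∈ condSet σ fun j => ∑ i, φ i * (B j i).eval σ := by
  simp only [condSet, Set.mem_ofPred_eq, comb_apply, eval_finsetSum, eval_mul, Finset.mul_sum,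
    Finset.sum_mul]
  rw [Finset.sum_comm]
  simp only [mul_comm, mul_assoc]

/-- The columns `(z - σ) e_a` and `e_j + μ_j e_a` for `j ≠ a`. -/
def pivotColumns {r : ℕ} (σ : ℂ) (a : Fin r) (μ : Fin r → ℂ) : Fin r → Fin r → ℂ[X] :=
  fun j => if j = a then Pi.single a (X - C σ) else Pi.single j 1 + Pi.single a (C (μ j))

theorem comb_pivotColumns_of_ne {r : ℕ} (σ : ℂ) {a i : Fin r} (μ : Fin r → ℂ)
    (α : Fin r → ℂ[X]) (hi : i ≠ a) : comb (pivotColumns σ a μ) α i = α i := by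
  rw [comb_apply, Finset.sum_eq_single i]
  · simp [pivotColumns, hi]
  · intro j _ hj
    by_cases hja : j = a <;> simp [pivotColumns, hja, hi, hj.symm]
  · simp

theorem comb_pivotColumns_self {r : ℕ} (σ : ℂ) (a : Fin r) (μ : Fin r → ℂ)
    (α : Fin r → ℂ[X]) : comb (pivotColumns σ a μ) α a =
      (X - C σ) * α a + ∑ j ∈ Finset.univ.erase a, C (μ j) * α j := by
  rw [comb_apply, ← Finset.add_sum_erase _ _ (Finset.mem_univ a)]
  congr 1
  · simp [pivotColumns, mul_comm]
  · refine Finset.sum_congr rfl fun j hj => ?_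
    have := Finset.ne_of_mem_erase hj
    simp [pivotColumns, this, this.symm, mul_comm]

/-- After division by φ_a the condition says that p_a + Σ (φ_j/φ_a) p_j is divisible by z - σ; its
quotient replaces p_a as a free coordinate. Maximality of τ_a ensures that the added multiples of
the other coordinates stay within the degree allowed for component a, and the factor z - σ lowers
the shift by one. -/
theorem isReducedMatrix_pivotColumns {r : ℕ} (σ : ℂ) (a : Fin r) (φ : Fin r → ℂ) (τ : Fin r → ℤ)
    (ha : φ a ≠ 0) (hmax : ∀ j, φ j ≠ 0 → τ j ≤ τ a) :
    IsReducedMatrix (condSet σ φ) τ (Function.update τ a (τ a - 1))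
      (pivotColumns σ a fun j => -(φ j / φ a)) := by
  set E := pivotColumns σ a fun j => -(φ j / φ a) with hE
  constructor
  · intro p
    set R := p a - ∑ j ∈ Finset.univ.erase a, C (-(φ j / φ a)) * p j with hR
    have h1 : p ∈ condSet σ φ ↔ R.eval σ = 0 := by
      have : ∑ i, φ i * (p i).eval σ = φ a * R.eval σ := by
        rw [hR, eval_sub, eval_finsetSum, mul_sub, Finset.mul_sum,
          ← Finset.add_sum_erase _ _ (Finset.mem_univ a), sub_eq_add_neg, ← Finset.sum_neg_distrib]
        congr 1
        refine Finset.sum_congr rfl fun j _ => ?_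
        simp only [eval_mul, eval_C]
        field_simp
      simp [condSet, this, ha]
    rw [h1]
    constructor
    · intro h
      obtain ⟨q, hq⟩ := dvd_iff_isRoot.mpr h
      -- Only coordinate a changes: it becomes the quotient of `R` by z - σ.
      refine ⟨Function.update p a q, funext fun i => ?_⟩
      by_cases hi : i = a
      · subst hi
        rw [comb_pivotColumns_self, Function.update_self, ← hq, hR]
        have : ∀ j ∈ Finset.univ.erase i, C (-(φ j / φ i)) * Function.update p i q j =
            C (-(φ j / φ i)) * p j := fun j hj => by
          rw [Function.update_of_ne (Finset.ne_of_mem_erase hj)]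
        rw [Finset.sum_congr rfl this, sub_add_cancel]
      · rw [comb_pivotColumns_of_ne _ _ _ hi, Function.update_of_ne hi]
    · rintro ⟨α, rfl⟩
      have : R = (X - C σ) * α a := by
        have : ∀ j ∈ Finset.univ.erase a, C (-(φ j / φ a)) * comb E α j =
            C (-(φ j / φ a)) * α j := fun j hj => by
          rw [hE, comb_pivotColumns_of_ne _ _ _ (Finset.ne_of_mem_erase hj)]
        rw [hR, Finset.sum_congr rfl this, comb_pivotColumns_self, add_sub_cancel_right]
      simp [this]
  · intro α
    refine withBot_eq_of_forall_le_iff fun d => ?_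
    rw [tauDeg_le_iff, tauDeg_le_iff]
    -- The choice of pivot is used here: each term has degree at most d + τ_j ≤ d + τ_a, or is zero
    -- because φ_j = 0.
    have hsum : (∀ j, j ≠ a → α j ∈ degLE (d + τ j)) →
        ∑ j ∈ Finset.univ.erase a, C (-(φ j / φ a)) * α j ∈ degLE (d + τ a) := by
      intro h
      refine Submodule.sum_mem _ fun j hj => ?_
      by_cases hφ : φ j = 0
      · simp [hφ]
      · have := mul_mem_degLE (C_mem_degLE_zero (-(φ j / φ a)))
          (h j (Finset.ne_of_mem_erase hj))
        exact degLE_mono (by linarith [hmax j hφ]) this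
    constructor
    · intro h i
      have h' : ∀ j, j ≠ a → α j ∈ degLE (d + τ j) := fun j hj => by
        simpa [hE, comb_pivotColumns_of_ne _ _ _ hj] using h j
      by_cases hi : i = a
      · subst hi
        have h2 := h i
        rw [comb_pivotColumns_self, Submodule.add_mem_iff_left _ (hsum h'),
          X_sub_C_mul_mem_degLE] at h2
        rw [Function.update_self]
        convert h2 using 2
        ring
      · rw [Function.update_of_ne hi]
        exact h' i hi
    · intro h i
      have h' : ∀ j, j ≠ a → α j ∈ degLE (d + τ j) := fun j hj => by
        simpa [Function.update_of_ne hj] using h j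
      by_cases hi : i = a
      · subst hi
        have h2 := h i
        rw [Function.update_self] at h2
        rw [comb_pivotColumns_self, Submodule.add_mem_iff_left _ (hsum h'),
          X_sub_C_mul_mem_degLE]
        convert h2 using 2
        ring
      · rw [hE, comb_pivotColumns_of_ne _ _ _ hi]
        exact h' i hi

theorem condSet_eq_univ {r : ℕ} {σ : ℂ} {φ : Fin r → ℂ} (h : ∀ i, φ i = 0) :
    condSet σ φ = Set.univ := by
  ext p
  simp [condSet, h]

theorem exists_isReducedMatrix_condSet {r : ℕ} (σ : ℂ) (φ : Fin r → ℂ) (τ : Fin r → ℤ) :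
    ∃ τ' E, IsReducedMatrix (condSet σ φ) τ τ' E := by
  by_cases h : ∀ i, φ i = 0
  · rw [condSet_eq_univ h]
    exact ⟨_, _, .one τ⟩
  · push Not at h
    obtain ⟨a, ha, hmax⟩ := Set.exists_max_image {i | φ i ≠ 0} τ (Set.toFinite _) h
    exact ⟨_, _, isReducedMatrix_pivotColumns σ a φ τ ha hmax⟩

/-- Needed apart from the program: in the general statement the three rows have arbitrary and
possibly different lengths, so their nodes do not form a single set of 2^e-th roots of unity. -/
theorem exists_isReducedMatrix {ι : Type} [Fintype ι] {r : ℕ} (σ : ι → ℂ) (φ : ι → Fin r → ℂ)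
    (τ : Fin r → ℤ) :
    ∃ τ' B, IsReducedMatrix (interpModule σ φ : Set (Fin r → ℂ[X])) τ τ' B := by
  classical
  have key : ∀ s : Finset ι, ∃ τ' B,
      IsReducedMatrix {p : Fin r → ℂ[X] | ∀ c ∈ s, p ∈ condSet (σ c) (φ c)} τ τ' B := by
    intro s
    induction s using Finset.induction_on with
    | empty => exact ⟨_, _, by simpa using IsReducedMatrix.one τ⟩
    | insert c s _ ih =>
      obtain ⟨τ', B, hB⟩ := ih
      obtain ⟨τ'', E, hE⟩ := exists_isReducedMatrix_condSet (σ c)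
        (fun j => ∑ i, φ c i * (B j i).eval (σ c)) τ'
      refine ⟨τ'', fun j => comb B (E j), ?_⟩
      have hset : condSet (σ c) (fun j => ∑ i, φ c i * (B j i).eval (σ c)) =
          {α | comb B α ∈ condSet (σ c) (φ c)} := by
        ext α
        exact (comb_mem_condSet B α).symm
      rw [hset] at hE
      convert hB.comp hE using 1
      ext p
      simp [and_comm]
  obtain ⟨τ', B, h⟩ := key Finset.univ
  refine ⟨τ', B, ?_⟩
  convert h using 1
  ext p
  simp [interpModule, condSet]

open Prog

/-! ## Correctness of the basis construction -/

theorem coeff_toPoly {d : ℕ} (v : Fin d → ℂ) (k : ℕ) :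
    (toPoly v).coeff k = if h : k < d then v ⟨k, h⟩ else 0 := by
  simp only [toPoly, finsetSum_coeff, coeff_C_mul, coeff_X_pow, mul_ite, mul_one, mul_zero]
  split_ifs with h
  · rw [Finset.sum_eq_single ⟨k, h⟩]
    · simp
    · intro b _ hb
      rw [if_neg]
      rintro rfl
      exact hb rfl
    · simp
  · refine Finset.sum_eq_zero fun i _ => ?_
    rw [if_neg]
    have := i.isLt
    omega

theorem eval_toPoly {d : ℕ} (v : Fin d → ℂ) (x : ℂ) :
    (toPoly v).eval x = ∑ i, v i * x ^ (i : ℕ) := by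
  simp [toPoly, eval_finsetSum]

theorem toPoly_mem_degLE {d : ℕ} (v : Fin d → ℂ) : toPoly v ∈ degLE ((d : ℤ) - 1) := by
  intro k hk
  rw [coeff_toPoly, dif_neg]
  omega

theorem toPoly_coeff {d : ℕ} {p : ℂ[X]} (hp : p ∈ degLE ((d : ℤ) - 1)) :
    toPoly (fun k : Fin d => p.coeff k) = p := by
  ext k
  rw [coeff_toPoly]
  split_ifs with h
  · rfl
  · exact (hp k (by omega)).symm

theorem toPoly_padVec {d d' : ℕ} (h : d ≤ d') (v : Fin d → ℂ) :
    toPoly (padVec d' 0 v) = toPoly v := by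
  ext k
  simp only [coeff_toPoly, padVec]
  split_ifs <;> first | rfl | omega

theorem run_fft_eq_eval (e : ℕ) (ζ : ℂ) (hζ : ζ ^ 2 ^ e = 1) (v : Fin (2 ^ e) → ℂ)
    (k : Fin (2 ^ e)) : (fft e ζ v).run k = (toPoly v).eval (ζ ^ (k : ℕ)) := by
  rw [run_fft e ζ hζ, eval_toPoly]
  simp only [← pow_mul, mul_comm]

theorem run_pivotP_eq_none {r : ℕ} {φ : Fin r → ℂ} {τ : Fin r → ℤ} {l : List (Fin r)}
    {best : Option (Fin r)} (h : (pivotP φ τ l best).run = none) :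
    best = none ∧ ∀ i ∈ l, φ i = 0 := by
  induction l generalizing best with
  | nil => simpa [pivotP] using h
  | cons i l ih =>
    simp only [pivotP, run_bind, run_isZeroP] at h
    by_cases hi : φ i = 0
    · simp only [hi, decide_true] at h
      have := ih h
      simpa [hi] using this
    · simp only [hi, decide_false] at h
      cases best with
      | none => simpa using (ih h).1
      | some j =>
        simp only [run_bind, run_compareP] at h
        have := (ih h).1
        by_cases hlt : τ j < τ i <;> simp [hlt] at this

/-- The last conclusion is the loop invariant: the current best index is only ever replaced by one
with a larger shift. -/
theorem run_pivotP_eq_some {r : ℕ} {φ : Fin r → ℂ} {τ : Fin r → ℤ} {l : List (Fin r)}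
    {best : Option (Fin r)} {a : Fin r} (hbest : ∀ j, best = some j → φ j ≠ 0)
    (h : (pivotP φ τ l best).run = some a) :
    φ a ≠ 0 ∧ (∀ i ∈ l, φ i ≠ 0 → τ i ≤ τ a) ∧ ∀ j, best = some j → τ j ≤ τ a := by
  induction l generalizing best with
  | nil =>
    simp only [pivotP, run_pure] at h
    subst h
    exact ⟨hbest a rfl, by simp, by simp⟩
  | cons i l ih =>
    simp only [pivotP, run_bind, run_isZeroP] at h
    by_cases hi : φ i = 0
    · simp only [hi, decide_true] at h
      obtain ⟨h1, h2, h3⟩ := ih hbest h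
      exact ⟨h1, by simpa [hi] using h2, h3⟩
    · simp only [hi, decide_false] at h
      cases best with
      | none =>
        obtain ⟨h1, h2, h3⟩ := ih (by simpa using hi) h
        exact ⟨h1, by simpa using ⟨fun _ => h3 i rfl, h2⟩, by simp⟩
      | some j =>
        simp only [run_bind, run_compareP, decide_eq_true_eq] at h
        have hj := hbest j rfl
        obtain ⟨h1, h2, h3⟩ := ih (by split_ifs <;> simp [hi, hj]) h
        split_ifs at h3 with hlt
        · have := h3 i rfl
          exact ⟨h1, by simpa using ⟨fun _ => this, h2⟩, by simpa using hlt.le.trans this⟩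
        · have := h3 j rfl
          exact ⟨h1, by simpa using ⟨fun _ => (not_lt.mp hlt).trans this, h2⟩, by simpa using this⟩

theorem cost_pivotP_le {r : ℕ} (φ : Fin r → ℂ) (τ : Fin r → ℤ) (l : List (Fin r))
    (best : Option (Fin r)) : (pivotP φ τ l best).cost ≤ 2 * l.length := by
  induction l generalizing best with
  | nil => simp [pivotP]
  | cons i l ih =>
    rw [pivotP, List.length_cons]
    refine (cost_bind_le (b := 2 * l.length + 1) (cost_isZeroP _).le fun y => ?_).trans (by omega)
    cases y with
    | true => exact (ih _).trans (by omega)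
    | false =>
      cases best with
      | none => exact (ih _).trans (by omega)
      | some j =>
        exact (cost_bind_le (cost_compareP _).le fun _ => ih _).trans (by omega)

/-- The vanishing top coefficient leaves room for the product in four coefficients; the `if`
excludes the cyclic wrap of `k - 1` at `k = 0`. -/
theorem toPoly_mul_X_sub_C {v : Fin 4 → ℂ} (σ : ℂ) (hv : v 3 = 0) :
    toPoly (fun k : Fin 4 => (if k = 0 then 0 else v (k - 1)) - σ * v k) =
      (X - C σ) * toPoly v := by
  simp only [toPoly, Fin.sum_univ_four, hv]
  simp [show (2 : Fin 4) - 1 = 1 from rfl, show (3 : Fin 4) - 1 = 2 from rfl]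
  ring

theorem toPoly_add_mul {d : ℕ} (v w : Fin d → ℂ) (μ : ℂ) :
    toPoly (fun k => v k + μ * w k) = toPoly v + C μ * toPoly w := by
  ext k
  simp only [coeff_toPoly, coeff_add, coeff_C_mul]
  split_ifs <;> simp

/-- The number t bounds the degrees of the entries before the step, and each condition raises the
bound by at most one; `t ≤ 2` keeps the result within four coefficients. -/
theorem run_singlePoint {r t : ℕ} (ht : t ≤ 2) {S : Set (Fin r → ℂ[X])} {τ : Fin r → ℤ}
    (σ : ℂ) (φ : Fin r → ℂ) {st : PolyMat ℂ r 4 × (Fin r → ℤ)}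
    (hst : IsReducedMatrix S τ st.2 (columns st.1))
    (hdeg : ∀ i j (k : Fin 4), t < (k : ℕ) → st.1 i j k = 0) :
    IsReducedMatrix (S ∩ condSet σ φ) τ (singlePoint σ φ st).run.2
        (columns (singlePoint σ φ st).run.1) ∧
      ∀ i j (k : Fin 4), t + 1 < (k : ℕ) → (singlePoint σ φ st).run.1 i j k = 0 := by
  obtain ⟨B, τ'⟩ := st
  simp only at hst hdeg
  set ψ : Fin r → ℂ := fun j => ∑ i, φ i * ∑ k, B i j k * σ ^ (k : ℕ) with hψ
  have hset : {α | comb (columns B) α ∈ condSet σ φ} = condSet σ ψ := by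
    ext α
    rw [Set.mem_ofPred_eq, comb_mem_condSet]
    simp only [columns, eval_toPoly, hψ]
  simp only [singlePoint, run_bind, run_constP, run_powersP, run_tab, run_dotP]
  rw [← hψ]
  cases hpiv : (pivotP ψ τ' (List.finRange r) none).run with
  | none =>
    simp only [run_pure]
    refine ⟨?_, fun i j k hk => hdeg i j k (by omega)⟩
    have h0 := (run_pivotP_eq_none hpiv).2
    -- Without a pivot the pulled-back condition is void, so S already satisfies the new condition.
    have hu : S ∩ condSet σ φ = S := by
      ext p
      refine ⟨fun h => h.1, fun h => ⟨h, ?_⟩⟩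
      obtain ⟨α, rfl⟩ := (hst.mem_iff p).mp h
      change α ∈ {α | comb (columns B) α ∈ condSet σ φ}
      rw [hset, condSet_eq_univ fun i => h0 i (List.mem_finRange i)]
      trivial
    rwa [hu]
  | some a =>
    obtain ⟨ha, hmax, -⟩ := run_pivotP_eq_some (by simp) hpiv
    have hE := isReducedMatrix_pivotColumns σ a ψ τ' ha
      fun j hj => hmax j (List.mem_finRange j) hj
    rw [← hset] at hE
    have hcomp := hst.comp hE
    simp only [run_bind, run_tab, run_pure, run_divP, run_subP, apply_ite Prog.run, run_mulP,
      run_addP, zero_sub]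
    constructor
    · convert hcomp using 1
      funext j i
      by_cases hj : j = a
      · subst hj
        simp only [columns, if_true, pivotColumns, comb_single, Pi.smul_apply, smul_eq_mul]
        exact toPoly_mul_X_sub_C σ (hdeg i j 3 (by change t < 3; omega))
      · have hc : ∀ α β, comb (columns B) (α + β) = comb (columns B) α + comb (columns B) β := by
          intro α β
          simp [comb, add_smul, Finset.sum_add_distrib]
        simp only [columns, hj, if_false, pivotColumns, hc, comb_single, Pi.smul_apply, smul_eq_mul,
          Pi.add_apply, one_mul]
        exact toPoly_add_mul _ _ _
    · intro i j k hk
      have hk0 : k ≠ 0 := by rintro rfl; simp at hk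
      have hk1 : t < ((k - 1 : Fin 4) : ℕ) := by
        rw [Fin.val_sub_one_of_ne_zero hk0]
        omega
      simp only [hk0, if_false, hdeg _ _ _ hk1, hdeg _ _ k (by omega)]
      simp

/-- A bound for the cost of including one condition. -/
def singlePointBound (r : ℕ) : ℕ := 1 + (4 + (r * (r * 9) + (r * (2 * r + 1) + (2 * r +
  (r * 2 + r * (r * 8))))))

theorem cost_singlePoint_le {r : ℕ} (σ : ℂ) (φ : Fin r → ℂ) (st : PolyMat ℂ r 4 × (Fin r → ℤ)) :
    (singlePoint σ φ st).cost ≤ singlePointBound r := by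
  rw [singlePoint]
  refine cost_bind_le (cost_constP _).le fun _ => cost_bind_le (cost_powersP _ _).le fun _ =>
    cost_bind_le (cost_tab_le fun _ => cost_tab_le fun _ => cost_dotP_le _ _) fun _ =>
    cost_bind_le (cost_tab_le fun _ => cost_dotP_le _ _) fun ψ =>
    cost_bind_le ((cost_pivotP_le _ _ _ _).trans (by simp)) fun piv => ?_
  cases piv with
  | none => simp
  | some a =>
    refine cost_bind_le (cost_tab_le fun _ => by simp) fun _ =>
      (cost_bind_le (b := 0) (cost_tab_le (c := r * 8) fun _ =>
        cost_tab_le (c := 8) fun j => (cost_tab_le (c := 2) fun k => ?_).trans (by norm_num))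
          fun _ => by simp).trans (by simp)
    split_ifs <;> simp

theorem run_tanInt {r t : ℕ} (ht : t ≤ 3) (σ : ℂ) (τ : Fin r → ℤ) (φ : Fin t → Fin r → ℂ) :
    IsReducedMatrix {p | ∀ i, p ∈ condSet σ (φ i)} τ (tanInt σ τ t φ).run.2
        (columns (tanInt σ τ t φ).run.1) ∧
      ∀ i j (k : Fin 4), t < (k : ℕ) → (tanInt σ τ t φ).run.1 i j k = 0 := by
  induction t with
  | zero =>
    simp only [tanInt, run_bind, run_constP, run_pure]
    constructor
    · convert IsReducedMatrix.one τ using 1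
      · ext p; simp
      · funext j i
        ext k
        by_cases hij : i = j
        · subst hij
          simp only [columns, coeff_toPoly, Pi.single_eq_same, coeff_one, true_and]
          rcases Nat.eq_zero_or_pos k with rfl | hk
          · simp
          · have : ∀ h : k < 4, (⟨k, h⟩ : Fin 4) ≠ 0 := fun h h' => by
              simp [Fin.ext_iff] at h'; omega
            simp [this, hk.ne']
        · simp [columns, coeff_toPoly, hij]
    · intro i j k hk
      have : k ≠ 0 := by rintro rfl; simp at hk
      simp [this]
  | succ t ih =>
    obtain ⟨h1, h2⟩ := ih (by omega) fun i => φ i.castSucc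
    simp only [tanInt, run_bind]
    have := run_singlePoint (by omega) σ (φ (Fin.last t)) h1 h2
    refine ⟨?_, this.2⟩
    convert this.1 using 1
    ext p
    simp [Fin.forall_fin_succ']

theorem cost_tanInt_le {r t : ℕ} (σ : ℂ) (τ : Fin r → ℤ) (φ : Fin t → Fin r → ℂ) :
    (tanInt σ τ t φ).cost ≤ 2 + t * singlePointBound r := by
  induction t with
  | zero => simp [tanInt]
  | succ t ih =>
    rw [tanInt, Nat.succ_mul, ← add_assoc]
    exact cost_bind_le (ih _) fun _ => cost_singlePoint_le _ _ _

/-! ### Evaluation and multiplication of polynomial matrices -/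

theorem sum_foldIdx {M : Type*} [AddCommMonoid M] (e : ℕ) (f : Fin (2 ^ (e + 2)) → M) :
    ∑ k, f k = ∑ i, ∑ t, f (foldIdx e i t) := by
  have h : 2 ^ (e + 2) = 4 * 2 ^ e := by rw [pow_add]; ring
  rw [← (finCongr h.symm).sum_comp, ← finProdFinEquiv.sum_comp, Fintype.sum_prod_type,
    Finset.sum_comm]
  refine Finset.sum_congr rfl fun k _ => Finset.sum_congr rfl fun t _ => ?_
  congr 1
  ext
  simp [foldIdx, finProdFinEquiv, mul_comm]

/-- At the points yη^k, coefficients whose indices differ by multiples of 2^e meet the same power of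
η. Weighted with powers of y, they can be added before a transform of length only 2^e. -/
theorem run_evalMat {r : ℕ} (e : ℕ) (y η : ℂ) (hη : η ^ 2 ^ e = 1)
    (B : PolyMat ℂ r (2 ^ (e + 2))) (i j : Fin r) (k : Fin (2 ^ e)) :
    (evalMat e y η B).run i j k = (toPoly (B i j)).eval (y * η ^ (k : ℕ)) := by
  simp only [evalMat, run_bind, run_tab, run_powersP, run_dotP, run_fft e η hη]
  rw [eval_toPoly, sum_foldIdx]
  refine Finset.sum_congr rfl fun a _ => ?_
  rw [Finset.sum_mul]
  refine Finset.sum_congr rfl fun t _ => ?_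
  have : (η ^ (k : ℕ)) ^ ((foldIdx e a t : Fin _) : ℕ) = η ^ ((a : ℕ) * k) := by
    simp only [foldIdx]
    rw [← pow_mul, mul_add, pow_add, mul_comm, show (k : ℕ) * (t * 2 ^ e) = 2 ^ e * (k * t) by ring,
      pow_mul η (2 ^ e), hη, one_pow, one_mul, mul_comm]
  rw [mul_pow, this, mul_assoc]

theorem cost_evalMat_le {r : ℕ} (e : ℕ) (y η : ℂ) (B : PolyMat ℂ r (2 ^ (e + 2))) :
    (evalMat e y η B).cost ≤ 2 ^ (e + 2) + r * (r * (2 ^ e * 9 + 4 * e * 2 ^ e)) := by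
  rw [evalMat]
  exact cost_bind_le (cost_powersP _ _).le fun _ => cost_tab_le fun _ => cost_tab_le fun _ =>
    cost_bind_le (cost_tab_le fun _ => cost_dotP_le _ _) fun _ => cost_fft_le _ _ _

/-- The product has fewer than 2 · 2^(e+2) coefficients, so a cyclic transform of length 2^(e+3)
causes no wrap-around and its values determine it. -/
theorem columns_run_mulMat {r : ℕ} (e : ℕ) (θ : ℂ) (hθ : IsPrimitiveRoot θ (2 ^ (e + 3)))
    (A B : PolyMat ℂ r (2 ^ (e + 2))) :
    columns (mulMat e θ A B).run = fun j => comb (columns A) (columns B j) := by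
  funext j i
  set P := comb (columns A) (columns B j) i with hP
  have hPdeg : P ∈ degLE (((2 ^ (e + 3) : ℕ) : ℤ) - 1) := by
    rw [hP, comb_apply]
    refine Submodule.sum_mem _ fun l _ => ?_
    refine degLE_mono ?_ (mul_mem_degLE (toPoly_mem_degLE _) (toPoly_mem_degLE _))
    rw [pow_succ 2 (e + 2)]
    push_cast
    omega
  have hle : 2 ^ (e + 2) ≤ 2 ^ (e + 3) := Nat.pow_le_pow_right (by norm_num) (by omega)
  simp only [mulMat, run_bind, run_tab, run_constP, run_dotP, columns]
  rw [run_ifft (u := fun k => P.coeff k) hθ, toPoly_coeff hPdeg]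
  intro k
  have h1 : ∑ j : Fin (2 ^ (e + 3)), P.coeff j * θ ^ ((j : ℕ) * (k : ℕ)) =
      P.eval (θ ^ (k : ℕ)) := by
    conv_rhs => rw [← toPoly_coeff hPdeg, eval_toPoly]
    simp only [← pow_mul, mul_comm]
  rw [h1, hP, comb_apply, eval_finsetSum]
  refine Finset.sum_congr rfl fun l _ => ?_
  rw [run_fft_eq_eval _ _ hθ.pow_eq_one, run_fft_eq_eval _ _ hθ.pow_eq_one, toPoly_padVec hle,
    toPoly_padVec hle, eval_mul, mul_comm]
  rfl

theorem cost_mulMat_le {r : ℕ} (e : ℕ) (θ : ℂ) (A B : PolyMat ℂ r (2 ^ (e + 2))) :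
    (mulMat e θ A B).cost ≤ 1 + (r * (r * (4 * (e + 3) * 2 ^ (e + 3))) +
      (r * (r * (4 * (e + 3) * 2 ^ (e + 3))) +
        r * (r * (2 ^ (e + 3) * (2 * r + 1) + (4 * (e + 3) + 4) * 2 ^ (e + 3))))) := by
  rw [mulMat]
  exact cost_bind_le (cost_constP _).le fun _ =>
    cost_bind_le (cost_tab_le fun _ => cost_tab_le fun _ => cost_fft_le _ _ _) fun _ =>
    cost_bind_le (cost_tab_le fun _ => cost_tab_le fun _ => cost_fft_le _ _ _) fun _ =>
    cost_tab_le fun _ => cost_tab_le fun _ =>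
      cost_bind_le (cost_tab_le fun _ => cost_dotP_le _ _) fun _ => cost_ifft_le _ _ _

/-! ### The recursion over even and odd nodes -/

theorem forall_even_odd {e : ℕ} {P : Fin (2 ^ (e + 1)) → Prop} :
    (∀ k, P k) ↔ (∀ k, P (evenIdx e k)) ∧ ∀ k, P (oddIdx e k) := by
  refine ⟨fun h => ⟨fun k => h _, fun k => h _⟩, fun h k => ?_⟩
  have hk : (k : ℕ) < 2 ^ e * 2 := k.isLt.trans_eq (pow_succ 2 e)
  rcases Nat.even_or_odd' (k : ℕ) with ⟨q, hq | hq⟩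
  · convert h.1 ⟨q, by omega⟩
    exact Fin.ext hq
  · convert h.2 ⟨q, by omega⟩
    exact Fin.ext hq

/-- The nodes cθ^(4k) split into c(θ²)^(4k) and cθ⁴(θ²)^(4k), two problems of the same form for θ².
The exponent 4 gives θ the order 2^(e+3) at level e + 1, exactly what the product of the two halves
needs. -/
theorem run_recTanInt {r s : ℕ} (hs : s ≤ 3) (e : ℕ) (θ c : ℂ)
    (hθ : IsPrimitiveRoot θ (2 ^ (e + 2))) (τ : Fin r → ℤ)
    (φ : Fin (2 ^ e) → Fin s → Fin r → ℂ) :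
    IsReducedMatrix {p | ∀ (k : Fin (2 ^ e)) t, p ∈ condSet (c * θ ^ (4 * (k : ℕ))) (φ k t)} τ
      (recTanInt e θ c τ φ).run.2 (columns (recTanInt e θ c τ φ).run.1) := by
  induction e generalizing θ c τ with
  | zero =>
    have h : {p | ∀ (k : Fin (2 ^ 0)) t, p ∈ condSet (c * θ ^ (4 * (k : ℕ))) (φ k t)} =
        {p | ∀ t, p ∈ condSet c (φ 0 t)} := by
      ext p
      change (∀ k : Fin 1, _) ↔ _
      simp
    rw [h]
    exact (run_tanInt hs c τ (φ 0)).1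
  | succ e ih =>
    have hθ₂ : IsPrimitiveRoot (θ * θ) (2 ^ (e + 2)) := by
      rw [← pow_two]
      exact hθ.pow (by positivity) (by rw [← pow_succ'])
    -- The ratio of consecutive odd nodes is η = θ⁸, and θ has order 2^(e+3) here.
    have hη : (θ * θ * (θ * θ) * (θ * θ * (θ * θ))) ^ 2 ^ e = 1 := by
      rw [← hθ.pow_eq_one, show θ * θ * (θ * θ) * (θ * θ * (θ * θ)) = θ ^ 8 by ring, ← pow_mul]
      congr 1
      ring
    simp only [recTanInt, run_bind, run_mulP, run_tab, run_dotP, run_pure, run_evalMat _ _ _ hη]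
    set L := (recTanInt e (θ * θ) c τ fun k => φ (evenIdx e k)).run with hL
    have hLred := ih (θ * θ) c hθ₂ τ fun k => φ (evenIdx e k)
    rw [← hL] at hLred
    set y := c * (θ * θ * (θ * θ)) with hy
    set φ' : Fin (2 ^ e) → Fin s → Fin r → ℂ := fun k t j => ∑ i, φ (oddIdx e k) t i *
      (toPoly (L.1 i j)).eval (y * (θ * θ * (θ * θ) * (θ * θ * (θ * θ))) ^ (k : ℕ)) with hφ'
    have hRred := ih (θ * θ) y hθ₂ L.2 φ'
    rw [columns_run_mulMat e θ hθ]
    -- The data passed to the right half are the odd conditions pulled back along the left basis, as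
    -- `comp` requires.
    have hset : {p | ∀ (k : Fin (2 ^ e)) t, p ∈ condSet (y * (θ * θ) ^ (4 * (k : ℕ))) (φ' k t)} =
        {α | comb (columns L.1) α ∈
          {p | ∀ (k : Fin (2 ^ e)) t,
            p ∈ condSet (y * (θ * θ) ^ (4 * (k : ℕ))) (φ (oddIdx e k) t)}} := by
      ext α
      simp only [Set.mem_ofPred_eq, comb_mem_condSet]
      have hnode : ∀ k : ℕ, (θ * θ * (θ * θ) * (θ * θ * (θ * θ))) ^ k = (θ * θ) ^ (4 * k) := by
        intro k
        rw [pow_mul]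
        congr 1
        ring
      simp only [hφ', hnode, columns]
    rw [hset] at hRred
    convert hLred.comp hRred using 1
    ext p
    simp only [Set.mem_ofPred_eq, Set.mem_inter_iff]
    rw [forall_even_odd]
    have he : ∀ k : Fin (2 ^ e), c * θ ^ (4 * (evenIdx e k : ℕ)) = c * (θ * θ) ^ (4 * (k : ℕ)) := by
      intro k
      simp only [evenIdx]
      rw [← pow_two, ← pow_mul]
      ring_nf
    have ho : ∀ k : Fin (2 ^ e), c * θ ^ (4 * (oddIdx e k : ℕ)) = y * (θ * θ) ^ (4 * (k : ℕ)) := by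
      intro k
      simp only [oddIdx]
      rw [hy, ← pow_two θ, ← pow_mul]
      ring
    simp only [he, ho]

/-- A bound for the cost of merging two halves, relative to `(e + 1) 2^e`. -/
def mergeBound (r : ℕ) : ℕ := 4 + 4 + 9 * r ^ 2 + 3 * (r * (2 * r + 1)) + 1 +
  8 * (24 * r ^ 2 + r ^ 2 * (2 * r + 1) + 16 * r ^ 2)

/-- A bound for the cost of the recursion, relative to `(e + 1)² 2^e`. -/
def recBound (r : ℕ) : ℕ := 2 + 3 * singlePointBound r + mergeBound r

/-- Solves the recurrence c(e+1) ≤ 2c(e) + D(e+1)2^e, with `singlePointBound` paying for the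
conditions at a single node. -/
theorem cost_recTanInt_le {r s : ℕ} (hs : s ≤ 3) (e : ℕ) (θ c : ℂ) (τ : Fin r → ℤ)
    (φ : Fin (2 ^ e) → Fin s → Fin r → ℂ) :
    (recTanInt e θ c τ φ).cost ≤ recBound r * (e + 1) ^ 2 * 2 ^ e := by
  induction e generalizing θ c τ with
  | zero =>
    refine (cost_tanInt_le c τ (φ 0)).trans ?_
    have := Nat.mul_le_mul_right (singlePointBound r) hs
    simp only [recBound]
    omega
  | succ e ih =>
    rw [recTanInt]
    refine (cost_bind_le (cost_mulP _ _).le fun _ => cost_bind_le (cost_mulP _ _).le fun _ =>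
      cost_bind_le (ih _ _ _ _) fun _ => cost_bind_le (cost_mulP _ _).le fun _ =>
      cost_bind_le (cost_mulP _ _).le fun _ => cost_bind_le (cost_evalMat_le _ _ _ _) fun _ =>
      cost_bind_le (b := recBound r * (e + 1) ^ 2 * 2 ^ e + (_ + 0))
        (cost_tab_le (c := 3 * (r * (2 * r + 1))) fun _ => (cost_tab_le fun _ =>
          cost_tab_le fun _ => cost_dotP_le _ _).trans (Nat.mul_le_mul_right _ hs)) fun _ =>
        cost_bind_le (ih _ _ _ _) fun _ => cost_bind_le (cost_mulMat_le _ _ _ _)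
          fun _ => (cost_pure _).le).trans ?_
    have hG : 4 + (2 ^ (e + 2) + r * (r * (2 ^ e * 9 + 4 * e * 2 ^ e)) +
        2 ^ e * (3 * (r * (2 * r + 1))) +
        (1 + (r * (r * (4 * (e + 3) * 2 ^ (e + 3))) + (r * (r * (4 * (e + 3) * 2 ^ (e + 3))) +
        r * (r * (2 ^ (e + 3) * (2 * r + 1) + (4 * (e + 3) + 4) * 2 ^ (e + 3))))))) ≤
        mergeBound r * ((e + 1) * 2 ^ e) := by
      have hP : 1 ≤ 2 ^ e := Nat.one_le_two_pow
      rw [pow_add 2 e 2, pow_add 2 e 3, mergeBound]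
      clear ih
      generalize 2 ^ e = P at hP ⊢
      -- With 2^e written as 1 + P both sides are polynomials with natural coefficients, and `omega`
      -- compares them with the monomials as atoms.
      obtain ⟨P, rfl⟩ := Nat.exists_eq_add_of_le hP
      ring_nf
      omega
    have hD : mergeBound r ≤ recBound r := by simp only [recBound]; omega
    have h1 : mergeBound r * ((e + 1) * 2 ^ e) ≤ recBound r * ((e + 1) * 2 ^ e) :=
      Nat.mul_le_mul_right _ hD
    -- Passing from (e+1)² to (e+2)² gains more than the merge costs; the last summand is slack.
    have h2 : recBound r * (e + 1 + 1) ^ 2 * 2 ^ (e + 1) =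
        2 * (recBound r * (e + 1) ^ 2 * 2 ^ e) + recBound r * ((e + 1) * 2 ^ e) +
          recBound r * ((3 * (e + 1) + 2) * 2 ^ e) := by
      rw [pow_succ 2 e]
      ring
    omega

theorem isPrimitiveRoot_exp_two_pow (e : ℕ) :
    IsPrimitiveRoot (Complex.exp (2 * Real.pi * Complex.I / (2 ^ e : ℕ))) (2 ^ e) :=
  Complex.isPrimitiveRoot_exp _ (by positivity)

theorem node_eq_pow (N : ℕ) (k : Fin N) :
    node N k = Complex.exp (2 * Real.pi * Complex.I / N) ^ (k : ℕ) := by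
  rw [node, ← Complex.exp_nat_mul]
  congr 1
  ring

theorem isReducedOutput_basisAtRoots {r s : ℕ} (hs : s ≤ 3) (e : ℕ) (τ : Fin r → ℤ)
    (φ : Fin (2 ^ e) → Fin s → Fin r → ℂ) :
    IsReducedOutput
      (interpModule (fun c : Fin (2 ^ e) × Fin s => node (2 ^ e) c.1) fun c => φ c.1 c.2) τ
      (basisAtRoots e τ φ).run := by
  have h := run_recTanInt hs e _ 1 (isPrimitiveRoot_exp_two_pow (e + 2)) τ φ
  have hset : {p | ∀ (k : Fin (2 ^ e)) t, p ∈ condSet (1 *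
      Complex.exp (2 * Real.pi * Complex.I / (2 ^ (e + 2) : ℕ)) ^ (4 * (k : ℕ))) (φ k t)} =
      (interpModule (fun c : Fin (2 ^ e) × Fin s => node (2 ^ e) c.1) fun c => φ c.1 c.2 :
        Set (Fin r → ℂ[X])) := by
    have hn : ∀ k : Fin (2 ^ e),
        1 * Complex.exp (2 * Real.pi * Complex.I / (2 ^ (e + 2) : ℕ)) ^ (4 * (k : ℕ)) =
          node (2 ^ e) k := by
      intro k
      rw [node, ← Complex.exp_nat_mul, one_mul]
      congr 1
      push_cast
      rw [pow_add]
      field_simp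
      ring
    ext p
    simp only [hn, Set.mem_ofPred_eq, interpModule, condSet]
    exact ⟨fun h c => h c.1 c.2, fun h k t => h (k, t)⟩
  rw [hset] at h
  have hrun : (basisAtRoots e τ φ).run = (recTanInt e
      (Complex.exp (2 * Real.pi * Complex.I / (2 ^ (e + 2) : ℕ))) 1 τ φ).run := by
    simp only [basisAtRoots, run_bind, run_rootConst, run_constP]
  rw [hrun]
  exact ⟨h.isTauReducedBasis, h.tauDeg_column⟩

theorem cost_basisAtRoots_le {r s : ℕ} (hs : s ≤ 3) (e : ℕ) (τ : Fin r → ℤ)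
    (φ : Fin (2 ^ e) → Fin s → Fin r → ℂ) :
    (basisAtRoots e τ φ).cost ≤ 2 + recBound r * (e + 1) ^ 2 * 2 ^ e := by
  rw [basisAtRoots]
  exact (cost_bind_le (cost_rootConst _).le fun _ => cost_bind_le (cost_constP _).le fun _ =>
    cost_recTanInt_le hs _ _ _ _ _).trans (by omega)

/-! ## Reading the solution off a reduced basis -/

theorem eq_zero_of_mem_degLE {t : ℤ} (ht : t < 0) {p : ℂ[X]} (hp : p ∈ degLE t) : p = 0 := by
  ext k
  simpa using hp k (by omega)

theorem eq_C_of_mem_degLE {p : ℂ[X]} (hp : p ∈ degLE 0) : p = C (p.coeff 0) := by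
  ext k
  rw [coeff_C]
  split_ifs with h
  · rw [h]
  · exact hp k (by omega)

theorem eq_linear_of_mem_degLE {p : ℂ[X]} (hp : p ∈ degLE 1) :
    p = C (p.coeff 0) + C (p.coeff 1) * X := by
  ext k
  rcases k with _ | _ | k
  · simp
  · simp
  · rw [hp _ (by push_cast; omega)]
    simp

theorem degree_map_add_le_iff {t d : ℤ} {p : ℂ[X]} :
    (p.degree.map fun d : ℕ => (d : ℤ)) + (d : WithBot ℤ) ≤ (t : WithBot ℤ) ↔
      p ∈ degLE (t - d) := by
  rw [sub_eq_add_neg, ← degree_map_le_iff]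
  cases p.degree with
  | bot => simp
  | coe n =>
    change (((n : ℤ) + d : ℤ) : WithBot ℤ) ≤ _ ↔ (((n : ℤ) - -d : ℤ) : WithBot ℤ) ≤ _
    rw [sub_neg_eq_add]

/-- Without cancellation every single term obeys the bound for the sum. All uses of reducedness
below have this form. -/
theorem IsTauReduced.mem_degLE {r k : ℕ} {τ : Fin r → ℤ} {B : Fin k → Fin r → ℂ[X]}
    (h : IsTauReduced τ B) {α : Fin k → ℂ[X]} {t d : ℤ} (ht : tauDeg τ (comb B α) ≤ t) {j : Fin k}
    (hd : d ≤ tauDeg τ (B j)) : α j ∈ degLE (t - d) := by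
  rw [comb, h α, Finset.sup_le_iff] at ht
  rw [← degree_map_add_le_iff]
  exact (add_le_add_right hd _).trans (ht j (Finset.mem_univ j))

namespace IsBasisOf

variable {r k : ℕ} {S : Submodule ℂ[X] (Fin r → ℂ[X])} {B : Fin k → Fin r → ℂ[X]}

theorem comb_mem (h : IsBasisOf S B) (α : Fin k → ℂ[X]) : comb B α ∈ S :=
  Submodule.sum_mem _ fun j _ => Submodule.smul_mem _ _ (h.1 j)

theorem comb_injective (h : IsBasisOf S B) : Function.Injective (comb B) := by
  intro α β hαβ
  exact (h.2 _ (h.comb_mem α)).unique rfl hαβ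

/-- The coordinates with respect to a basis. -/
def linearEquiv (h : IsBasisOf S B) : (Fin k → ℂ[X]) ≃ₗ[ℂ[X]] S :=
  LinearEquiv.ofBijective
    ((Fintype.linearCombination ℂ[X] B).codRestrict S fun α => h.comb_mem α)
    ⟨fun _ _ hαβ => h.comb_injective (congrArg Subtype.val hαβ), fun p => by
      obtain ⟨α, hα, -⟩ := h.2 p p.2
      exact ⟨α, Subtype.ext hα.symm⟩⟩

/-- Invariance of rank for free modules over ℂ[z]. -/
theorem card_eq (h : IsBasisOf S B) {l : ℕ} {B' : Fin l → Fin r → ℂ[X]} (h' : IsBasisOf S B') :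
    k = l := by
  simpa using (h.linearEquiv.trans h'.linearEquiv.symm).finrank_eq

end IsBasisOf

theorem coe_add_one_le {d : ℤ} {a : WithBot ℤ} (h : ¬ a ≤ (d : WithBot ℤ)) :
    ((d + 1 : ℤ) : WithBot ℤ) ≤ a := by
  induction a with
  | bot => simp at h
  | coe a =>
    rw [WithBot.coe_le_coe] at *
    omega

/-- The vector polynomial whose components have the given coefficients. -/
def coeffMap {r : ℕ} (d : Fin r → ℕ) : ((i : Fin r) × Fin (d i) → ℂ) →ₗ[ℂ] Fin r → ℂ[X] where
  toFun v i := toPoly fun k => v ⟨i, k⟩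
  map_add' v w := by
    funext i
    simp [toPoly, add_mul, Finset.sum_add_distrib]
  map_smul' c v := by
    funext i
    simp [toPoly, Finset.smul_sum, smul_eq_C_mul, mul_assoc]

theorem coeffMap_injective {r : ℕ} (d : Fin r → ℕ) : Function.Injective (coeffMap d) := by
  intro v w h
  funext ⟨i, k⟩
  have := congrArg (fun p => (p i).coeff k) h
  simpa [coeffMap, coeff_toPoly] using this

/-- The left-hand sides of interpolation conditions. -/
def condMap {ι : Type} {r : ℕ} (σ : ι → ℂ) (φ : ι → Fin r → ℂ) :
    (Fin r → ℂ[X]) →ₗ[ℂ] ι → ℂ where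
  toFun p c := ∑ i, φ c i * (p i).eval (σ c)
  map_add' p q := by
    funext c
    simp [mul_add, Finset.sum_add_distrib]
  map_smul' a p := by
    funext c
    simp [Finset.mul_sum, mul_left_comm]

theorem mem_interpModule_iff {ι : Type} {r : ℕ} {σ : ι → ℂ} {φ : ι → Fin r → ℂ}
    {p : Fin r → ℂ[X]} : p ∈ interpModule σ φ ↔ condMap σ φ p = 0 := by
  simp only [funext_iff]
  rfl

/-- Rank-nullity: each condition lowers the dimension of a space of truncated vector polynomials by
at most one. -/
theorem exists_le_finrank {ι : Type} [Fintype ι] {r : ℕ} (σ : ι → ℂ) (φ : ι → Fin r → ℂ)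
    (d : Fin r → ℕ) : ∃ W : Submodule ℂ (Fin r → ℂ[X]),
      ∑ i, d i ≤ Module.finrank ℂ W + Fintype.card ι ∧
      ∀ f ∈ W, f ∈ interpModule σ φ ∧ ∀ i, f i ∈ degLE ((d i : ℤ) - 1) := by
  set Φ := (condMap σ φ).comp (coeffMap d) with hΦ
  refine ⟨(LinearMap.ker Φ).map (coeffMap d), ?_, ?_⟩
  · rw [← (Submodule.equivMapOfInjective _ (coeffMap_injective d) _).finrank_eq]
    have h1 := LinearMap.finrank_range_add_finrank_ker Φ
    have h2 := Submodule.finrank_le (LinearMap.range Φ)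
    simp at h1 h2
    omega
  · rintro f ⟨v, hv, rfl⟩
    exact ⟨mem_interpModule_iff.mpr hv, fun i => toPoly_mem_degLE _⟩

/-- The line spanned by `q` settles which τ-degrees are at most 0; `hcount` excludes τ-degrees above
1 by comparing dimensions over ℂ, without determinants. -/
theorem readOffBases_interpModule {ι : Type} [Fintype ι] {r n : ℕ} {σ : ι → ℂ}
    {φ : ι → Fin (r + 1) → ℂ} {τ : Fin (r + 1) → ℤ} {x : Fin n → ℂ} {q : Fin (r + 1) → ℂ[X]}
    (hqS : q ∈ interpModule σ φ) (hqx : q 0 = toPoly x) (hqlast : q (Fin.last r) = 1)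
    (hq0 : tauDeg τ q = 0)
    (hspan : ∀ f ∈ interpModule σ φ, tauDeg τ f ≤ 0 → ∃ α : ℂ, f = (C α : ℂ[X]) • q)
    (hτ : ∀ i, -2 ≤ τ i) (hcount : (Fintype.card ι : ℤ) + r + 2 ≤ ∑ i, (τ i + 2)) :
    ReadOffBases (interpModule σ φ) τ x := by
  obtain ⟨τ', B₀, hB₀⟩ := exists_isReducedMatrix σ φ τ
  have hB₀ := hB₀.isTauReducedBasis
  refine ⟨fun k B hB => hB.card_eq hB₀.1, ⟨B₀, hB₀⟩, fun B ⟨hB, hred⟩ => ?_⟩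
  have hqne : q ≠ 0 := by
    intro h
    rw [h] at hqlast
    simp at hqlast
  -- If all τ-degrees were at least 1, every coefficient of `q` would have degree at most -1 and `q`
  -- would vanish.
  obtain ⟨j, hj⟩ : ∃ j, tauDeg τ (B j) ≤ (0 : ℤ) := by
    by_contra! hc
    obtain ⟨α, hα, -⟩ := hB.2 q hqS
    apply hqne
    rw [hα]
    refine Finset.sum_eq_zero fun j _ => ?_
    have h1 : tauDeg τ (comb B α) ≤ (0 : ℤ) := by
      rw [comb, ← hα, hq0]
      rfl
    have := hred.mem_degLE h1 (coe_add_one_le (hc j).not_ge)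
    rw [eq_zero_of_mem_degLE (by norm_num) this, zero_smul]
  obtain ⟨β, hβ⟩ := hspan _ (hB.1 j) hj
  have hβ0 : β ≠ 0 := by
    rintro rfl
    have h1 : comb B (Pi.single j 1) = comb B 0 := by
      rw [comb_single, one_smul, hβ]
      simp [comb]
    have := congrFun (hB.comb_injective h1) j
    simp at this
  have hqB : q = (C β⁻¹ : ℂ[X]) • B j := by
    rw [hβ, smul_smul, ← C_mul, inv_mul_cancel₀ hβ0, C_1, one_smul]
  have hsmul : ∀ (c : ℂ) (f : Fin (r + 1) → ℂ[X]) (d : ℤ), tauDeg τ f ≤ d →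
      tauDeg τ ((C c : ℂ[X]) • f) ≤ d := by
    intro c f d hd
    rw [tauDeg_le_iff] at *
    intro i
    rw [Pi.smul_apply, smul_eq_mul, ← zero_add (d + τ i)]
    exact mul_mem_degLE (C_mem_degLE_zero c) (hd i)
  have hj0 : tauDeg τ (B j) = 0 := by
    rw [← hq0]
    refine withBot_eq_of_forall_le_iff fun d => ⟨fun h => ?_, fun h => ?_⟩
    · rw [hqB]
      exact hsmul _ _ _ h
    · rw [hβ]
      exact hsmul _ _ _ h
  -- A second element of τ-degree at most 0 would be a scalar multiple of `q`, hence of `B j`,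
  -- against uniqueness of coordinates.
  have hpos : ∀ i, i ≠ j → ((1 : ℤ) : WithBot ℤ) ≤ tauDeg τ (B i) := by
    intro i hij
    by_contra hc
    have hle : tauDeg τ (B i) ≤ (0 : ℤ) := by
      by_contra h
      exact hc (coe_add_one_le h)
    obtain ⟨γ, hγ⟩ := hspan _ (hB.1 i) hle
    have h1 : comb B (Pi.single i 1) = comb B (Pi.single j (C γ * C β⁻¹)) := by
      rw [comb_single, comb_single, one_smul, hγ, hqB, smul_smul]
    have := congrFun (hB.comb_injective h1) i
    simp [hij] at this
  refine ⟨j, hj0, fun i hij => ?_, β, hβ0, ?_, ?_⟩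
  · refine le_antisymm ?_ (hpos i hij)
    by_contra hc
    have h2 : ((2 : ℤ) : WithBot ℤ) ≤ tauDeg τ (B i) := coe_add_one_le (d := 1) hc
    -- Allowing τ_i + 2 coefficients in component i means τ-degree at most 1.
    obtain ⟨W, hW, hWmem⟩ := exists_le_finrank σ φ fun i => (τ i + 2).toNat
    -- An element of τ-degree at most 1 cannot involve `B i`, so its slot is free for z `B j`; the
    -- other coefficients are constants, apart from a linear one at `B j`.
    set g : Fin (r + 1) → Fin (r + 1) → ℂ[X] :=
      fun l => if l = i then (X : ℂ[X]) • B j else B l with hg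
    have hCsmul : ∀ (c : ℂ) (f : Fin (r + 1) → ℂ[X]), (C c : ℂ[X]) • f = c • f := by
      intro c f
      funext l
      simp [smul_eq_C_mul]
    have hgmem : ∀ l, g l ∈ Submodule.span ℂ (Set.range g) :=
      fun l => Submodule.subset_span ⟨l, rfl⟩
    have hle : W ≤ Submodule.span ℂ (Set.range g) := by
      intro f hf
      obtain ⟨hfS, hfdeg⟩ := hWmem f hf
      obtain ⟨α, rfl, -⟩ := hB.2 f hfS
      have h1 : tauDeg τ (comb B α) ≤ (1 : ℤ) := by
        rw [tauDeg_le_iff]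
        intro l
        have h3 := hfdeg l
        rw [Int.toNat_of_nonneg (by linarith [hτ l])] at h3
        rwa [show τ l + 2 - 1 = 1 + τ l by ring] at h3
      refine Submodule.sum_mem _ fun l _ => ?_
      by_cases hli : l = i
      · rw [hli, eq_zero_of_mem_degLE (by norm_num) (hred.mem_degLE h1 h2), zero_smul]
        exact zero_mem _
      by_cases hlj : l = j
      · have h3 : α j ∈ degLE 1 := hred.mem_degLE (d := 0) h1 hj0.ge
        have h4 : B j = g j := by simp [hg, Ne.symm hij]
        have h5 : (X : ℂ[X]) • B j = g i := by simp [hg]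
        rw [hlj, eq_linear_of_mem_degLE h3, add_smul, mul_smul, hCsmul, hCsmul, h5, h4]
        exact add_mem (Submodule.smul_mem _ _ (hgmem _)) (Submodule.smul_mem _ _ (hgmem _))
      · have h3 : α l ∈ degLE 0 := hred.mem_degLE (d := 1) h1 (hpos l hlj)
        have h4 : B l = g l := by simp [hg, hli]
        rw [eq_C_of_mem_degLE h3, hCsmul, h4]
        exact Submodule.smul_mem _ _ (hgmem _)
    have : FiniteDimensional ℂ (Submodule.span ℂ (Set.range g)) :=
      FiniteDimensional.span_of_finite ℂ (Set.finite_range g)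
    have h3 := Submodule.finrank_mono hle
    have h4 : Module.finrank ℂ (Submodule.span ℂ (Set.range g)) ≤ r + 1 := by
      simpa [Set.finrank] using finrank_range_le_card (R := ℂ) g
    have h5 : ((∑ i, (τ i + 2).toNat : ℕ) : ℤ) = ∑ i, (τ i + 2) := by
      push_cast
      refine Finset.sum_congr rfl fun l _ => ?_
      exact Int.toNat_of_nonneg (by linarith [hτ l])
    rw [← h5] at hcount
    omega
  · simp [hβ, hqlast]
  · rw [hβ, Pi.smul_apply, smul_eq_mul, hqx, ← mul_assoc, ← C_mul, inv_mul_cancel₀ hβ0, C_1,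
      one_mul]

/-! ## Block rows of circulant matrices -/

theorem interpModule_inf {ι κ : Type} {r : ℕ} (σ : ι → ℂ) (φ : ι → Fin r → ℂ) (σ' : κ → ℂ)
    (φ' : κ → Fin r → ℂ) : interpModule σ φ ⊓ interpModule σ' φ' =
      interpModule (Sum.elim σ σ') (Sum.elim φ φ') := by
  ext p
  exact ⟨fun h c => c.casesOn (fun a => h.1 a) fun a => h.2 a,
    fun h => ⟨fun a => h (Sum.inl a), fun a => h (Sum.inr a)⟩⟩

theorem isPrimitiveRoot_exp {N : ℕ} (k : Fin N) :
    IsPrimitiveRoot (Complex.exp (2 * Real.pi * Complex.I / N)) N :=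
  Complex.isPrimitiveRoot_exp _ k.pos.ne'

theorem fourier_mulVec_apply {N : ℕ} (u : Fin N → ℂ) (k : Fin N) :
    (fourier N).mulVec u k = ∑ j, u j *
      Complex.exp (2 * Real.pi * Complex.I / N) ^ ((j : ℕ) * (k : ℕ)) := by
  simp only [Matrix.mulVec, dotProduct, fourier, Matrix.of_apply, node_eq_pow, ← pow_mul]
  simp only [mul_comm]

theorem fourier_mulVec_injective (N : ℕ) : Function.Injective (fourier N).mulVec := by
  intro u v h
  funext l
  have key : ∀ u : Fin N → ℂ, ∑ k, (fourier N).mulVec u k *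
      (Complex.exp (2 * Real.pi * Complex.I / N))⁻¹ ^ ((k : ℕ) * (l : ℕ)) = u l * N := by
    intro u
    have hω := isPrimitiveRoot_exp l
    simp only [fourier_mulVec_apply]
    generalize Complex.exp (2 * Real.pi * Complex.I / N) = ω at hω ⊢
    simp only [Finset.sum_mul, mul_assoc]
    rw [Finset.sum_comm]
    simp only [← Finset.mul_sum, sum_pow_eq_ite hω]
    simp
  have hN : (N : ℂ) ≠ 0 := Nat.cast_ne_zero.mpr l.pos.ne'
  exact mul_right_cancel₀ hN (by rw [← key, ← key, h])

/-- The circulant matrix with first column `c`, applied to the coefficients of `f`. -/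
def cyc {N : ℕ} (c : Fin N → ℂ) (f : ℂ[X]) : Fin N → ℂ :=
  (Matrix.circulant c).mulVec fun i => f.coeff i

/-- The degree bound says that the first N coefficients are all of f, so their transform consists of
the values of f at the nodes. -/
theorem fourier_mulVec_cyc {N : ℕ} (c : Fin N → ℂ) {f : ℂ[X]} (hf : f ∈ degLE ((N : ℤ) - 1))
    (k : Fin N) :
    (fourier N).mulVec (cyc c f) k = (fourier N).mulVec c k * f.eval (node N k) := by
  have hev : (fourier N).mulVec (fun i => f.coeff i) k = f.eval (node N k) := by
    conv_rhs => rw [← toPoly_coeff hf, eval_toPoly]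
    simp only [Matrix.mulVec, dotProduct, fourier, Matrix.of_apply, mul_comm]
  rw [cyc, Matrix.mulVec_mulVec, fourier_mul_circulant, ← Matrix.mulVec_mulVec,
    Matrix.mulVec_diagonal, hev]

theorem cyc_zero_left {N : ℕ} (f : ℂ[X]) : cyc (0 : Fin N → ℂ) f = 0 := by
  funext k
  simp [cyc, Matrix.mulVec, dotProduct, Matrix.circulant_apply]

theorem cyc_neg_left {N : ℕ} (c : Fin N → ℂ) (f : ℂ[X]) : cyc (-c) f = -cyc c f := by
  funext k
  simp [cyc, Matrix.mulVec, dotProduct, Matrix.circulant_apply]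

/-- By injectivity of the Fourier matrix, the N conditions are N linear equations in the
coefficients. Components with zero column need no bound; they may be longer than this row, since the
rows have different lengths. -/
theorem mem_blockRowModule_iff {N r : ℕ} {c : Fin r → Fin N → ℂ} {f : Fin r → ℂ[X]}
    (hf : ∀ j, c j = 0 ∨ f j ∈ degLE ((N : ℤ) - 1)) :
    f ∈ blockRowModule N c ↔ ∑ j, cyc (c j) (f j) = 0 := by
  rw [← (fourier_mulVec_injective N).eq_iff, Matrix.mulVec_zero, funext_iff]
  refine forall_congr' fun k => ?_
  have : (fourier N).mulVec (∑ j, cyc (c j) (f j)) k =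
      ∑ j, (fourier N).mulVec (c j) k * (f j).eval (node N k) := by
    rw [Matrix.mulVec_sum, Finset.sum_apply]
    refine Finset.sum_congr rfl fun j _ => ?_
    rcases hf j with h | h
    · simp [h, cyc_zero_left]
    · exact fourier_mulVec_cyc _ h k
  rw [this]
  rfl

theorem sum_fin_of_le {ν N : ℕ} (h : ν ≤ N) {g : Fin N → ℂ}
    (hg : ∀ j : Fin N, ν ≤ (j : ℕ) → g j = 0) :
    ∑ j, g j = ∑ j : Fin ν, g (Fin.castLE h j) := by
  refine Eq.trans ?_ (Finset.sum_map Finset.univ (Fin.castLEEmb h) g)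
  symm
  refine Finset.sum_subset (Finset.subset_univ _) fun j _ hj => hg j ?_
  by_contra! hlt
  exact hj (Finset.mem_map.mpr ⟨⟨j, hlt⟩, Finset.mem_univ _, Fin.ext rfl⟩)

/-- The last rows of the circulant extension reproduce the Toeplitz matrix. -/
theorem cyc_circGen {N μ ν : ℕ} {A : Matrix (Fin μ) (Fin ν) ℂ} {a : ℤ → ℂ}
    (hA : ∀ i j, A i j = a ((i : ℤ) - (j : ℤ))) (hν : 0 < ν) (hN : μ + ν - 1 ≤ N) {f : ℂ[X]}
    (hf : f ∈ degLE ((ν : ℤ) - 1)) (i : Fin μ) (h : N - μ + (i : ℕ) < N) :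
    cyc (circGen N μ a) f ⟨N - μ + i, h⟩ = A.mulVec (fun j => f.coeff j) i := by
  have hi := i.isLt
  have hνN : ν ≤ N := by omega
  simp only [cyc, Matrix.mulVec, dotProduct]
  rw [sum_fin_of_le hνN fun j hj => by rw [hf _ (by omega), mul_zero]]
  refine Finset.sum_congr rfl fun j _ => ?_
  have hj := j.isLt
  rw [Matrix.circulant_apply, circGen, hA]
  congr 2
  -- No wrap-around: j ≤ ν - 1 ≤ N - μ, so the cyclic difference of the indices is the ordinary one.
  rw [Fin.sub_val_of_le (by rw [Fin.le_def]; simp only [Fin.val_castLE]; omega)]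
  simp only [Fin.val_castLE]
  omega

/-- A cyclic shift by t; the degree bound makes the entries that wrap around zero. -/
theorem cyc_unitVec {N t : ℕ} (ht : t < N) {f : ℂ[X]} (hf : f ∈ degLE ((N : ℤ) - t - 1))
    (k : Fin N) :
    cyc (unitVec N t 0 1) f k = if t ≤ (k : ℕ) then f.coeff ((k : ℕ) - t) else 0 := by
  have : NeZero N := ⟨by omega⟩
  simp only [cyc, Matrix.mulVec, dotProduct]
  rw [Finset.sum_eq_single (k - ⟨t, ht⟩)]
  · rw [Matrix.circulant_apply, unitVec, sub_sub_cancel, if_pos rfl, one_mul]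
    split_ifs with hk
    · rw [Fin.sub_val_of_le (by rw [Fin.le_def]; exact hk)]
    · rw [Fin.coe_sub_iff_lt.mpr (by rw [Fin.lt_def]; simpa using hk)]
      have := k.isLt
      refine hf _ ?_
      simp only
      omega
  · intro j _ hj
    rw [Matrix.circulant_apply, unitVec, if_neg, zero_mul]
    intro h
    apply hj
    have : k - j = ⟨t, ht⟩ := Fin.ext h
    rw [← this, sub_sub_cancel]
  · simp

theorem cyc_C {N : ℕ} (c : Fin N → ℂ) (β : ℂ) (k : Fin N) : cyc c (C β) k = c k * β := by
  have : NeZero N := ⟨k.pos.ne'⟩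
  simp only [cyc, Matrix.mulVec, dotProduct]
  rw [Finset.sum_eq_single 0]
  · simp [Matrix.circulant_apply]
  · intro j _ hj
    rw [coeff_C, if_neg, mul_zero]
    intro h
    exact hj (Fin.ext (by simpa using h))
  · simp

theorem coeff_toPoly_fin {d : ℕ} (v : Fin d → ℂ) :
    (fun j : Fin d => (toPoly v).coeff j) = v := by
  funext j
  simp [coeff_toPoly]

theorem eq_toPoly_iff {d : ℕ} {p : ℂ[X]} (hp : p ∈ degLE ((d : ℤ) - 1)) (v : Fin d → ℂ) :
    p = toPoly v ↔ ∀ i : Fin d, p.coeff i = v i := by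
  constructor
  · rintro rfl i
    exact congrFun (coeff_toPoly_fin v) i
  · intro h
    rw [← toPoly_coeff hp]
    congr 1
    exact funext h

/-- Separates the Toeplitz rows at the bottom from the extension rows above them. -/
theorem forall_fin_split {N μ : ℕ} (hμ : μ ≤ N) {P : Fin N → Prop} :
    (∀ k, P k) ↔ (∀ i : Fin μ, P ⟨N - μ + i, by omega⟩) ∧
      ∀ k : Fin (N - μ), P ⟨k, by omega⟩ := by
  refine ⟨fun h => ⟨fun i => h _, fun k => h _⟩, fun h k => ?_⟩
  by_cases hk : (k : ℕ) < N - μ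
  · exact h.2 ⟨k, hk⟩
  · have := h.1 ⟨k - (N - μ), by omega⟩
    convert this
    simp only
    omega

/-- The block row `[-C(A), [0; I], [I; 0]]` expresses `σ = A x` and determines `γ`. -/
theorem definingRow_iff {N μ ν : ℕ} {A : Matrix (Fin μ) (Fin ν) ℂ} {a : ℤ → ℂ}
    (hA : ∀ i j, A i j = a ((i : ℤ) - (j : ℤ))) (hμ : 0 < μ) (hν : 0 < ν) (hN : μ + ν - 1 ≤ N)
    {x σ γ : ℂ[X]} (hx : x ∈ degLE ((ν : ℤ) - 1)) (hσ : σ ∈ degLE ((μ : ℤ) - 1))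
    (hγ : γ ∈ degLE ((N : ℤ) - μ - 1)) :
    cyc (-circGen N μ a) x + cyc (unitVec N (N - μ) 0 1) σ + cyc (unitVec N 0 0 1) γ = 0 ↔
      σ = toPoly (A.mulVec fun j => x.coeff j) ∧
      γ = toPoly fun k : Fin (N - μ) => cyc (circGen N μ a) x ⟨k, by omega⟩ := by
  have hμN : μ ≤ N := by omega
  rw [eq_toPoly_iff hσ, eq_toPoly_iff (by rwa [Nat.cast_sub hμN]), funext_iff,
    forall_fin_split hμN]
  refine and_congr (forall_congr' fun i => ?_) (forall_congr' fun k => ?_)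
  -- In the last μ rows γ is absent, having only N - μ coefficients.
  · have hi := i.isLt
    simp only [Pi.add_apply, cyc_neg_left, Pi.neg_apply]
    rw [cyc_circGen hA hν hN hx, cyc_unitVec (by omega) (by rw [Nat.cast_sub hμN]; simpa using hσ),
      cyc_unitVec (by omega) (degLE_mono (by simp) hγ), if_pos (by simp), if_pos (by simp),
      hγ _ (by push_cast; omega), Pi.zero_apply, add_zero, neg_add_eq_zero, eq_comm]
    simp
  -- In the first N - μ rows σ is absent, being shifted below them.
  · have hk := k.isLt
    simp only [Pi.add_apply, cyc_neg_left, Pi.neg_apply]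
    rw [cyc_unitVec (by omega) (by rw [Nat.cast_sub hμN]; simpa using hσ),
      cyc_unitVec (by omega) (degLE_mono (by simp) hγ), if_neg (by simp only; omega),
      if_pos (by simp),
      Pi.zero_apply, add_zero, neg_add_eq_zero, eq_comm]
    simp

/-- The block row `[C(A), C(B), [I; 0], [0; -y]]` expresses `A u + B v = β y` and determines
`γ`. -/
theorem equationRow_iff {N n ν κ : ℕ} {A : Matrix (Fin n) (Fin ν) ℂ} {B : Matrix (Fin n) (Fin κ) ℂ}
    {a b : ℤ → ℂ} (hA : ∀ i j, A i j = a ((i : ℤ) - (j : ℤ)))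
    (hB : ∀ i j, B i j = b ((i : ℤ) - (j : ℤ))) (hn : 0 < n) (hν : 0 < ν) (hκ : 0 < κ)
    (hN : n + ν - 1 ≤ N) (hN' : n + κ - 1 ≤ N) {u v γ : ℂ[X]} (hu : u ∈ degLE ((ν : ℤ) - 1))
    (hv : v ∈ degLE ((κ : ℤ) - 1)) (hγ : γ ∈ degLE ((N : ℤ) - n - 1)) (β : ℂ) (y : Fin n → ℂ) :
    cyc (circGen N n a) u + cyc (circGen N n b) v + cyc (unitVec N 0 0 1) γ +
        cyc (bottom N 0 (-y)) (C β) = 0 ↔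
      A.mulVec (fun j => u.coeff j) + B.mulVec (fun j => v.coeff j) = β • y ∧
      γ = toPoly fun k : Fin (N - n) =>
        -(cyc (circGen N n a) u + cyc (circGen N n b) v) ⟨k, by omega⟩ := by
  have hnN : n ≤ N := by omega
  rw [eq_toPoly_iff (by rwa [Nat.cast_sub hnN]), funext_iff, funext_iff, forall_fin_split hnN]
  refine and_congr (forall_congr' fun i => ?_) (forall_congr' fun k => ?_)
  · have hi := i.isLt
    simp only [Pi.add_apply]
    rw [cyc_circGen hA hν hN hu, cyc_circGen hB hκ hN' hv,
      cyc_unitVec (by omega) (degLE_mono (by simp) hγ), if_pos (by simp),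
      hγ _ (by push_cast; omega), cyc_C, bottom, dif_pos (by simp)]
    simp [add_neg_eq_zero, mul_comm]
  · have hk := k.isLt
    simp only [Pi.add_apply]
    rw [cyc_unitVec (by omega) (degLE_mono (by simp) hγ), if_pos (by simp), cyc_C, bottom,
      dif_neg (by simp only; omega)]
    simp only [zero_mul, add_zero, Pi.zero_apply, Nat.sub_zero]
    rw [add_comm, add_eq_zero_iff_eq_neg]

/-! ## The interpolation problems -/

theorem mulVec_tikhonovSolution {m n p : ℕ} {T : Matrix (Fin m) (Fin n) ℂ}
    {L : Matrix (Fin p) (Fin n) ℂ} (b : Fin m → ℂ)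
    (h : IsUnit (T.conjTranspose * T + L.conjTranspose * L)) :
    (T.conjTranspose * T + L.conjTranspose * L).mulVec (tikhonovSolution T L b) =
      T.conjTranspose.mulVec b := by
  rw [tikhonovSolution, Matrix.mulVec_mulVec,
    Matrix.mul_nonsing_inv _ ((Matrix.isUnit_iff_isUnit_det _).mp h), Matrix.one_mulVec]

theorem toPoly_zero (d : ℕ) : toPoly (0 : Fin d → ℂ) = 0 := by
  simp [toPoly]

theorem cyc_zero_right {N : ℕ} (c : Fin N → ℂ) : cyc c 0 = 0 := by
  funext k
  simp [cyc, Matrix.mulVec, dotProduct]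

theorem eq_zero_of_coeff_fin {d : ℕ} {p : ℂ[X]} (hp : p ∈ degLE ((d : ℤ) - 1))
    (h : (fun j : Fin d => p.coeff j) = 0) : p = 0 := by
  rw [← toPoly_coeff hp, h, toPoly_zero]

theorem tauDeg_eq_zero {r : ℕ} {τ : Fin r → ℤ} {p : Fin r → ℂ[X]} (h : ∀ i, p i ∈ degLE (τ i))
    {j : Fin r} (hj : p j = 1) (hτ : τ j = 0) : tauDeg τ p = 0 := by
  refine le_antisymm (tauDeg_le_iff (d := 0).mpr fun i => by simpa using h i) ?_
  refine coe_add_one_le (d := -1) fun hc => ?_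
  have := tauDeg_le_iff.mp hc j
  rw [hj, hτ] at this
  exact one_ne_zero (eq_zero_of_mem_degLE (by norm_num) this)

/-- If `q ∈ S` has `τ`-degree at most zero and last component `1`, and only zero has `τ`-degree at
most zero and last component `0`, then `q` spans the elements of `τ`-degree at most zero. -/
theorem tauDeg_le_zero_iff_exists {r : ℕ} {S : Submodule ℂ[X] (Fin r → ℂ[X])} {τ : Fin r → ℤ}
    {q : Fin r → ℂ[X]} {l : Fin r} (hq : q ∈ S) (hdeg : ∀ i, q i ∈ degLE (τ i)) (hl : q l = 1)
    (hτ : τ l = 0)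
    (hz : ∀ g ∈ S, (∀ i, g i ∈ degLE (τ i)) → g l = 0 → g = 0) :
    ∀ f ∈ S, tauDeg τ f ≤ 0 ↔ ∃ α : ℂ, f = (C α : ℂ[X]) • q := by
  have hsmul : ∀ (α : ℂ) i, ((C α : ℂ[X]) • q) i ∈ degLE (τ i) := by
    intro α i
    rw [← zero_add (τ i)]
    exact mul_mem_degLE (C_mem_degLE_zero α) (hdeg i)
  intro f hf
  have hle : tauDeg τ f ≤ 0 ↔ ∀ i, f i ∈ degLE (τ i) := by
    have := tauDeg_le_iff (τ := τ) (p := f) (d := 0)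
    simpa using this
  rw [hle]
  constructor
  · intro h
    refine ⟨(f l).coeff 0, sub_eq_zero.mp (hz _ (sub_mem hf (S.smul_mem _ hq))
      (fun i => sub_mem (h i) (hsmul _ i)) ?_)⟩
    rw [Pi.sub_apply, Pi.smul_apply, hl, smul_eq_mul, mul_one, sub_eq_zero]
    exact eq_C_of_mem_degLE (hτ ▸ h l)
  · rintro ⟨α, rfl⟩
    exact hsmul α

theorem mem_generalModule_iff {m n p N₁ N₂ N₃ : ℕ} {T : Matrix (Fin m) (Fin n) ℂ}
    {L : Matrix (Fin p) (Fin n) ℂ} {a l aH lH : ℤ → ℂ} (hm : 0 < m) (hn : 0 < n) (hp : 0 < p)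
    (hT : ∀ i j, T i j = a ((i : ℤ) - (j : ℤ))) (hL : ∀ i j, L i j = l ((i : ℤ) - (j : ℤ)))
    (hTH : ∀ i j, T.conjTranspose i j = aH ((i : ℤ) - (j : ℤ)))
    (hLH : ∀ i j, L.conjTranspose i j = lH ((i : ℤ) - (j : ℤ)))
    (h₁ : max m p + n - 1 ≤ N₁) (h₂ : m + n - 1 ≤ N₂) (h₃ : p + n - 1 ≤ N₃) (y : Fin n → ℂ)
    {f : Fin 7 → ℂ[X]} (hf : ∀ i, f i ∈ degLE (generalTau m n p N₁ N₂ N₃ i)) :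
    f ∈ generalModule m n p N₁ N₂ N₃ aH lH a l y ↔
      ((T.conjTranspose.mulVec (fun j => (f 1).coeff j) +
          L.conjTranspose.mulVec (fun j => (f 2).coeff j) = (f 6).coeff 0 • y ∧
        f 3 = toPoly fun k : Fin (N₁ - n) =>
          -(cyc (circGen N₁ n aH) (f 1) + cyc (circGen N₁ n lH) (f 2)) ⟨k, by omega⟩) ∧
      (f 1 = toPoly (T.mulVec fun j => (f 0).coeff j) ∧
        f 4 = toPoly fun k : Fin (N₂ - m) => cyc (circGen N₂ m a) (f 0) ⟨k, by omega⟩)) ∧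
      (f 2 = toPoly (L.mulVec fun j => (f 0).coeff j) ∧
        f 5 = toPoly fun k : Fin (N₃ - p) => cyc (circGen N₃ p l) (f 0) ⟨k, by omega⟩) := by
  have f0 : f 0 ∈ degLE ((n : ℤ) - 1) := hf 0
  have f1 : f 1 ∈ degLE ((m : ℤ) - 1) := hf 1
  have f2 : f 2 ∈ degLE ((p : ℤ) - 1) := hf 2
  have f3 : f 3 ∈ degLE ((N₁ : ℤ) - n - 1) := hf 3
  have f4 : f 4 ∈ degLE ((N₂ : ℤ) - m - 1) := hf 4
  have f5 : f 5 ∈ degLE ((N₃ : ℤ) - p - 1) := hf 5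
  have f6 : f 6 ∈ degLE 0 := hf 6
  rw [← equationRow_iff hTH hLH hn hm hp (by omega) (by omega) f1 f2 f3,
    ← definingRow_iff hT hm hn h₂ f0 f1 f4, ← definingRow_iff hL hp hn h₃ f0 f2 f5,
    ← eq_C_of_mem_degLE f6, generalModule, Submodule.mem_inf, Submodule.mem_inf]
  have z : ∀ N (g : ℂ[X]), cyc (fun _ : Fin N => (0 : ℂ)) g = 0 := fun N g => cyc_zero_left g
  refine and_congr (and_congr ?_ ?_) ?_
  · rw [mem_blockRowModule_iff]
    · simp [Fin.sum_univ_seven, generalRow₁, z]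
    -- Zero columns are dismissed by `.inl`; every other component is shorter than N₁.
    · intro j
      fin_cases j
      exacts [.inl rfl, .inr (degLE_mono (by omega) f1), .inr (degLE_mono (by omega) f2),
        .inr (degLE_mono (by omega) f3), .inl rfl, .inl rfl, .inr (degLE_mono (by omega) f6)]
  · rw [mem_blockRowModule_iff]
    · simp [Fin.sum_univ_seven, generalRow₂, z]
    · intro j
      fin_cases j
      exacts [.inr (degLE_mono (by omega) f0), .inr (degLE_mono (by omega) f1), .inl rfl, .inl rfl,
        .inr (degLE_mono (by omega) f4), .inl rfl, .inl rfl]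
  · rw [mem_blockRowModule_iff]
    · simp [Fin.sum_univ_seven, generalRow₃, z]
    · intro j
      fin_cases j
      exacts [.inr (degLE_mono (by omega) f0), .inl rfl, .inr (degLE_mono (by omega) f2), .inl rfl,
        .inl rfl, .inr (degLE_mono (by omega) f5), .inl rfl]

/-- Substituting σ₁ and σ₂ turns the first row into the normal equations with right-hand side βTᴴb.
For β = 1 they give the solution; for β = 0 invertibility annihilates x, and with it the other
components. -/
theorem generalModule_solution {m n p N₁ N₂ N₃ : ℕ} {T : Matrix (Fin m) (Fin n) ℂ}
    {L : Matrix (Fin p) (Fin n) ℂ} {a l aH lH : ℤ → ℂ} (hm : 0 < m) (hn : 0 < n) (hp : 0 < p)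
    (hT : ∀ i j, T i j = a ((i : ℤ) - (j : ℤ))) (hL : ∀ i j, L i j = l ((i : ℤ) - (j : ℤ)))
    (hTH : ∀ i j, T.conjTranspose i j = aH ((i : ℤ) - (j : ℤ)))
    (hLH : ∀ i j, L.conjTranspose i j = lH ((i : ℤ) - (j : ℤ)))
    (h₁ : max m p + n - 1 ≤ N₁) (h₂ : m + n - 1 ≤ N₂) (h₃ : p + n - 1 ≤ N₃) (b : Fin m → ℂ)
    (hunit : IsUnit (T.conjTranspose * T + L.conjTranspose * L)) :
    ∃ q ∈ generalModule m n p N₁ N₂ N₃ aH lH a l (T.conjTranspose.mulVec b),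
      q 0 = toPoly (tikhonovSolution T L b) ∧
      q 1 = toPoly (T.mulVec (tikhonovSolution T L b)) ∧
      q 2 = toPoly (L.mulVec (tikhonovSolution T L b)) ∧ q 6 = 1 ∧
      tauDeg (generalTau m n p N₁ N₂ N₃) q = 0 ∧
      ∀ f ∈ generalModule m n p N₁ N₂ N₃ aH lH a l (T.conjTranspose.mulVec b),
        tauDeg (generalTau m n p N₁ N₂ N₃) f ≤ 0 ↔ ∃ α : ℂ, f = (C α : ℂ[X]) • q := by
  set x := tikhonovSolution T L b
  have hmem := fun (f : Fin 7 → ℂ[X]) hf => mem_generalModule_iff (f := f) hm hn hp hT hL hTH hLH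
    h₁ h₂ h₃ (T.conjTranspose.mulVec b) hf
  set q : Fin 7 → ℂ[X] := ![toPoly x, toPoly (T.mulVec x), toPoly (L.mulVec x),
    toPoly fun k : Fin (N₁ - n) => -(cyc (circGen N₁ n aH) (toPoly (T.mulVec x)) +
      cyc (circGen N₁ n lH) (toPoly (L.mulVec x))) ⟨k, by omega⟩,
    toPoly fun k : Fin (N₂ - m) => cyc (circGen N₂ m a) (toPoly x) ⟨k, by omega⟩,
    toPoly fun k : Fin (N₃ - p) => cyc (circGen N₃ p l) (toPoly x) ⟨k, by omega⟩, 1]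
  have hdeg : ∀ i, q i ∈ degLE (generalTau m n p N₁ N₂ N₃ i) := by
    intro i
    fin_cases i
    · exact toPoly_mem_degLE _
    · exact toPoly_mem_degLE _
    · exact toPoly_mem_degLE _
    · exact degLE_mono (by simp [generalTau]; omega) (toPoly_mem_degLE _)
    · exact degLE_mono (by simp [generalTau]; omega) (toPoly_mem_degLE _)
    · exact degLE_mono (by simp [generalTau]; omega) (toPoly_mem_degLE _)
    · exact C_mem_degLE_zero 1
  have hqS : q ∈ generalModule m n p N₁ N₂ N₃ aH lH a l (T.conjTranspose.mulVec b) := by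
    rw [hmem q hdeg]
    have hc0 : (fun j : Fin n => (q 0).coeff j) = x := coeff_toPoly_fin _
    have hc1 : (fun j : Fin m => (q 1).coeff j) = T.mulVec x := coeff_toPoly_fin _
    have hc2 : (fun j : Fin p => (q 2).coeff j) = L.mulVec x := coeff_toPoly_fin _
    have hc6 : (q 6).coeff 0 = 1 := coeff_one_zero
    rw [hc0, hc1, hc2, hc6, one_smul, Matrix.mulVec_mulVec, Matrix.mulVec_mulVec,
      ← Matrix.add_mulVec]
    exact ⟨⟨⟨mulVec_tikhonovSolution b hunit, rfl⟩, rfl, rfl⟩, rfl, rfl⟩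
  refine ⟨q, hqS, rfl, rfl, rfl, rfl, tauDeg_eq_zero (j := 6) hdeg rfl rfl,
    tauDeg_le_zero_iff_exists (l := 6) hqS hdeg rfl rfl fun g hg hgdeg hg6 => ?_⟩
  obtain ⟨⟨⟨e0, e3⟩, e1, e4⟩, e2, e5⟩ := (hmem g hgdeg).mp hg
  have hc1 : (fun j : Fin m => (g 1).coeff j) = T.mulVec fun j => (g 0).coeff j := by
    rw [e1, coeff_toPoly_fin]
  have hc2 : (fun j : Fin p => (g 2).coeff j) = L.mulVec fun j => (g 0).coeff j := by
    rw [e2, coeff_toPoly_fin]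
  rw [hc1, hc2, hg6, coeff_zero, zero_smul, Matrix.mulVec_mulVec, Matrix.mulVec_mulVec,
    ← Matrix.add_mulVec] at e0
  have hv : (fun j : Fin n => (g 0).coeff j) = 0 :=
    Matrix.mulVec_injective_of_isUnit hunit (e0.trans (Matrix.mulVec_zero _).symm)
  have g0 : g 0 = 0 := eq_zero_of_coeff_fin (hgdeg 0) hv
  have g1 : g 1 = 0 := by rw [e1, hv, Matrix.mulVec_zero, toPoly_zero]
  have g2 : g 2 = 0 := by rw [e2, hv, Matrix.mulVec_zero, toPoly_zero]
  rw [g1, g2, cyc_zero_right, cyc_zero_right, add_zero] at e3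
  rw [g0, cyc_zero_right] at e4 e5
  funext i
  fin_cases i
  · exact g0
  · exact g1
  · exact g2
  · exact e3.trans (by simp [toPoly])
  · exact e4.trans (toPoly_zero _)
  · exact e5.trans (toPoly_zero _)
  · exact hg6

theorem readOffBases_generalModule {m n p N₁ N₂ N₃ : ℕ} {T : Matrix (Fin m) (Fin n) ℂ}
    {L : Matrix (Fin p) (Fin n) ℂ} {a l aH lH : ℤ → ℂ} (hm : 0 < m) (hn : 0 < n) (hp : 0 < p)
    (hT : ∀ i j, T i j = a ((i : ℤ) - (j : ℤ))) (hL : ∀ i j, L i j = l ((i : ℤ) - (j : ℤ)))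
    (hTH : ∀ i j, T.conjTranspose i j = aH ((i : ℤ) - (j : ℤ)))
    (hLH : ∀ i j, L.conjTranspose i j = lH ((i : ℤ) - (j : ℤ)))
    (h₁ : max m p + n - 1 ≤ N₁) (h₂ : m + n - 1 ≤ N₂) (h₃ : p + n - 1 ≤ N₃) (b : Fin m → ℂ)
    (hunit : IsUnit (T.conjTranspose * T + L.conjTranspose * L)) :
    ReadOffBases (generalModule m n p N₁ N₂ N₃ aH lH a l (T.conjTranspose.mulVec b))
      (generalTau m n p N₁ N₂ N₃) (tikhonovSolution T L b) := by
  obtain ⟨q, hqS, hq0, -, -, hq6, hdeg, hspan⟩ :=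
    generalModule_solution hm hn hp hT hL hTH hLH h₁ h₂ h₃ b hunit
  rw [generalModule, blockRowModule, blockRowModule, blockRowModule, interpModule_inf,
    interpModule_inf] at *
  refine readOffBases_interpModule hqS hq0 hq6 hdeg (fun f hf => (hspan f hf).mp) ?_ ?_
  · intro i
    fin_cases i <;> simp [generalTau] <;> omega
  -- The shifts add up to N₁ + N₂ + N₃ - 6, so Σ(τ_i + 2) exceeds the number of conditions by
  -- exactly 8 = r + 2.
  · simp [Fin.sum_univ_seven, generalTau]
    omega

/-! ### The variant with Toeplitz Gramian -/

theorem mem_gramModule_iff {n p N₁ N₂ : ℕ} {G : Matrix (Fin n) (Fin n) ℂ}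
    {L : Matrix (Fin p) (Fin n) ℂ} {g l lH : ℤ → ℂ} (hn : 0 < n) (hp : 0 < p)
    (hG : ∀ i j, G i j = g ((i : ℤ) - (j : ℤ))) (hL : ∀ i j, L i j = l ((i : ℤ) - (j : ℤ)))
    (hLH : ∀ i j, L.conjTranspose i j = lH ((i : ℤ) - (j : ℤ)))
    (h₁ : max n p + n - 1 ≤ N₁) (h₂ : p + n - 1 ≤ N₂) (y : Fin n → ℂ)
    {f : Fin 5 → ℂ[X]} (hf : ∀ i, f i ∈ degLE (gramTau n p N₁ N₂ i)) :
    f ∈ gramModule n p N₁ N₂ g lH l y ↔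
      (G.mulVec (fun j => (f 0).coeff j) +
          L.conjTranspose.mulVec (fun j => (f 1).coeff j) = (f 4).coeff 0 • y ∧
        f 2 = toPoly fun k : Fin (N₁ - n) =>
          -(cyc (circGen N₁ n g) (f 0) + cyc (circGen N₁ n lH) (f 1)) ⟨k, by omega⟩) ∧
      (f 1 = toPoly (L.mulVec fun j => (f 0).coeff j) ∧
        f 3 = toPoly fun k : Fin (N₂ - p) => cyc (circGen N₂ p l) (f 0) ⟨k, by omega⟩) := by
  have f0 : f 0 ∈ degLE ((n : ℤ) - 1) := hf 0
  have f1 : f 1 ∈ degLE ((p : ℤ) - 1) := hf 1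
  have f2 : f 2 ∈ degLE ((N₁ : ℤ) - n - 1) := hf 2
  have f3 : f 3 ∈ degLE ((N₂ : ℤ) - p - 1) := hf 3
  have f4 : f 4 ∈ degLE 0 := hf 4
  rw [← equationRow_iff hG hLH hn hn hp (by omega) (by omega) f0 f1 f2,
    ← definingRow_iff hL hp hn h₂ f0 f1 f3,
    ← eq_C_of_mem_degLE f4, gramModule, Submodule.mem_inf]
  have z : ∀ N (g : ℂ[X]), cyc (fun _ : Fin N => (0 : ℂ)) g = 0 := fun N g => cyc_zero_left g
  refine and_congr ?_ ?_
  · rw [mem_blockRowModule_iff]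
    · simp [Fin.sum_univ_five, gramRow₁, z]
    · intro j
      fin_cases j
      exacts [.inr (degLE_mono (by omega) f0), .inr (degLE_mono (by omega) f1),
        .inr (degLE_mono (by omega) f2), .inl rfl, .inr (degLE_mono (by omega) f4)]
  · rw [mem_blockRowModule_iff]
    · simp [Fin.sum_univ_five, gramRow₂, z]
    · intro j
      fin_cases j
      exacts [.inr (degLE_mono (by omega) f0), .inr (degLE_mono (by omega) f1), .inl rfl,
        .inr (degLE_mono (by omega) f3), .inl rfl]

/-- As in the general case, but the Gramian acts on x directly, so no unknown Tx is needed and T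
itself need not be Toeplitz. -/
theorem gramModule_solution {m n p N₁ N₂ : ℕ} {T : Matrix (Fin m) (Fin n) ℂ}
    {L : Matrix (Fin p) (Fin n) ℂ} {g l lH : ℤ → ℂ} (hn : 0 < n) (hp : 0 < p)
    (hG : ∀ i j, (T.conjTranspose * T) i j = g ((i : ℤ) - (j : ℤ)))
    (hL : ∀ i j, L i j = l ((i : ℤ) - (j : ℤ)))
    (hLH : ∀ i j, L.conjTranspose i j = lH ((i : ℤ) - (j : ℤ)))
    (h₁ : max n p + n - 1 ≤ N₁) (h₂ : p + n - 1 ≤ N₂) (b : Fin m → ℂ)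
    (hunit : IsUnit (T.conjTranspose * T + L.conjTranspose * L)) :
    ∃ q ∈ gramModule n p N₁ N₂ g lH l (T.conjTranspose.mulVec b),
      q 0 = toPoly (tikhonovSolution T L b) ∧
      q 1 = toPoly (L.mulVec (tikhonovSolution T L b)) ∧ q 4 = 1 ∧
      tauDeg (gramTau n p N₁ N₂) q = 0 ∧
      ∀ f ∈ gramModule n p N₁ N₂ g lH l (T.conjTranspose.mulVec b),
        tauDeg (gramTau n p N₁ N₂) f ≤ 0 ↔ ∃ α : ℂ, f = (C α : ℂ[X]) • q := by
  set x := tikhonovSolution T L b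
  have hmem := fun (f : Fin 5 → ℂ[X]) hf => mem_gramModule_iff (f := f) hn hp hG hL hLH
    h₁ h₂ (T.conjTranspose.mulVec b) hf
  set q : Fin 5 → ℂ[X] := ![toPoly x, toPoly (L.mulVec x),
    toPoly fun k : Fin (N₁ - n) => -(cyc (circGen N₁ n g) (toPoly x) +
      cyc (circGen N₁ n lH) (toPoly (L.mulVec x))) ⟨k, by omega⟩,
    toPoly fun k : Fin (N₂ - p) => cyc (circGen N₂ p l) (toPoly x) ⟨k, by omega⟩, 1]
  have hdeg : ∀ i, q i ∈ degLE (gramTau n p N₁ N₂ i) := by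
    intro i
    fin_cases i
    · exact toPoly_mem_degLE _
    · exact toPoly_mem_degLE _
    · exact degLE_mono (by simp [gramTau]; omega) (toPoly_mem_degLE _)
    · exact degLE_mono (by simp [gramTau]; omega) (toPoly_mem_degLE _)
    · exact C_mem_degLE_zero 1
  have hqS : q ∈ gramModule n p N₁ N₂ g lH l (T.conjTranspose.mulVec b) := by
    rw [hmem q hdeg]
    have hc0 : (fun j : Fin n => (q 0).coeff j) = x := coeff_toPoly_fin _
    have hc1 : (fun j : Fin p => (q 1).coeff j) = L.mulVec x := coeff_toPoly_fin _
    have hc4 : (q 4).coeff 0 = 1 := coeff_one_zero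
    rw [hc0, hc1, hc4, one_smul, Matrix.mulVec_mulVec, ← Matrix.add_mulVec]
    exact ⟨⟨mulVec_tikhonovSolution b hunit, rfl⟩, rfl, rfl⟩
  refine ⟨q, hqS, rfl, rfl, rfl, tauDeg_eq_zero (j := 4) hdeg rfl rfl,
    tauDeg_le_zero_iff_exists (l := 4) hqS hdeg rfl rfl fun f hf hfdeg hf4 => ?_⟩
  obtain ⟨⟨e0, e2⟩, e1, e3⟩ := (hmem f hfdeg).mp hf
  have hc1 : (fun j : Fin p => (f 1).coeff j) = L.mulVec fun j => (f 0).coeff j := by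
    rw [e1, coeff_toPoly_fin]
  rw [hc1, hf4, coeff_zero, zero_smul, Matrix.mulVec_mulVec, ← Matrix.add_mulVec] at e0
  have hv : (fun j : Fin n => (f 0).coeff j) = 0 :=
    Matrix.mulVec_injective_of_isUnit hunit (e0.trans (Matrix.mulVec_zero _).symm)
  have f0 : f 0 = 0 := eq_zero_of_coeff_fin (hfdeg 0) hv
  have f1 : f 1 = 0 := by rw [e1, hv, Matrix.mulVec_zero, toPoly_zero]
  rw [f0, f1, cyc_zero_right, cyc_zero_right, add_zero] at e2
  rw [f0, cyc_zero_right] at e3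
  funext i
  fin_cases i
  · exact f0
  · exact f1
  · exact e2.trans (by simp [toPoly])
  · exact e3.trans (toPoly_zero _)
  · exact hf4

theorem readOffBases_gramModule {m n p N₁ N₂ : ℕ} {T : Matrix (Fin m) (Fin n) ℂ}
    {L : Matrix (Fin p) (Fin n) ℂ} {g l lH : ℤ → ℂ} (hn : 0 < n) (hp : 0 < p)
    (hG : ∀ i j, (T.conjTranspose * T) i j = g ((i : ℤ) - (j : ℤ)))
    (hL : ∀ i j, L i j = l ((i : ℤ) - (j : ℤ)))
    (hLH : ∀ i j, L.conjTranspose i j = lH ((i : ℤ) - (j : ℤ)))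
    (h₁ : max n p + n - 1 ≤ N₁) (h₂ : p + n - 1 ≤ N₂) (b : Fin m → ℂ)
    (hunit : IsUnit (T.conjTranspose * T + L.conjTranspose * L)) :
    ReadOffBases (gramModule n p N₁ N₂ g lH l (T.conjTranspose.mulVec b))
      (gramTau n p N₁ N₂) (tikhonovSolution T L b) := by
  obtain ⟨q, hqS, hq0, -, hq4, hdeg, hspan⟩ :=
    gramModule_solution hn hp hG hL hLH h₁ h₂ b hunit
  rw [gramModule, blockRowModule, blockRowModule, interpModule_inf] at *
  refine readOffBases_interpModule hqS hq0 hq4 hdeg (fun f hf => (hspan f hf).mp) ?_ ?_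
  · intro i
    fin_cases i <;> simp [gramTau] <;> omega
  -- The shifts add up to N₁ + N₂ - 4; here the excess is 6 = r + 2.
  · simp [Fin.sum_univ_five, gramTau]
    omega

/-! ## The solvers -/

theorem run_transformRow {r : ℕ} (e : ℕ) (c : Fin r → Fin (2 ^ e) → ℂ) :
    (transformRow e (Complex.exp (2 * Real.pi * Complex.I / (2 ^ e : ℕ))) c).run =
      fun j => (fourier (2 ^ e)).mulVec (c j) := by
  funext j k
  simp only [transformRow, run_tab, run_fft e _ (isPrimitiveRoot_exp_two_pow e).pow_eq_one,
    fourier_mulVec_apply]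

theorem run_negP {d : ℕ} (v : Fin d → ℂ) : (negP 0 v).run = -v := by
  funext k
  simp [negP]

/-- The convolution theorem; when `c` extends Tᴴ, these entries are Tᴴb by `cyc_circGen`. -/
theorem run_convBottom {e n m : ℕ} (hn : n ≤ 2 ^ e) (hm : m ≤ 2 ^ e) (c : Fin (2 ^ e) → ℂ)
    (b : Fin m → ℂ) :
    (convBottom e n (Complex.exp (2 * Real.pi * Complex.I / (2 ^ e : ℕ))) 0 c
      (padVec (2 ^ e) 0 b)).run = fun i : Fin n => cyc c (toPoly b) ⟨2 ^ e - n + i, by omega⟩ := by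
  have hω := isPrimitiveRoot_exp_two_pow e
  have hb : toPoly b ∈ degLE (((2 ^ e : ℕ) : ℤ) - 1) :=
    degLE_mono (by have : (m : ℤ) ≤ ((2 ^ e : ℕ) : ℤ) := by exact_mod_cast hm
                   omega) (toPoly_mem_degLE b)
  funext i
  simp only [convBottom, run_bind, run_tab, run_mulP, run_pure]
  rw [dif_pos (by omega), run_ifft (u := cyc c (toPoly b)) hω]
  intro k
  rw [← fourier_mulVec_apply, fourier_mulVec_cyc c hb, fourier_mulVec_apply,
    run_fft e _ hω.pow_eq_one, run_fft_eq_eval e _ hω.pow_eq_one, toPoly_padVec hm, node_eq_pow]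

theorem cost_convBottom_le (e n : ℕ) (ω z : ℂ) (c v : Fin (2 ^ e) → ℂ) :
    (convBottom e n ω z c v).cost ≤ (12 * e + 5) * 2 ^ e := by
  rw [convBottom]
  refine (cost_bind_le (cost_fft_le _ _ _) fun _ => cost_bind_le (cost_fft_le _ _ _) fun _ =>
    cost_bind_le (cost_tab_le (c := 1) fun _ => by simp) fun _ =>
    cost_bind_le (cost_ifft_le _ _ _) fun _ => (cost_pure _).le).trans (le_of_eq ?_)
  ring

theorem le_two_pow_sizeExp (q n : ℕ) : q + n ≤ 2 ^ sizeExp q n :=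
  Nat.le_pow_clog (by norm_num) _

/-- Diagonals of a matrix with ν columns satisfy i - j > -ν, so the zero filling touches only
arbitrary entries. -/
theorem eq_truncSymbol {μ ν : ℕ} {A : Matrix (Fin μ) (Fin ν) ℂ} {a : ℤ → ℂ}
    (hA : ∀ i j, A i j = a ((i : ℤ) - (j : ℤ))) (i : Fin μ) (j : Fin ν) :
    A i j = truncSymbol 0 ν a ((i : ℤ) - (j : ℤ)) := by
  rw [truncSymbol, if_pos (by omega), hA]

theorem conjTranspose_eq_symbol {μ ν : ℕ} {A : Matrix (Fin μ) (Fin ν) ℂ} {a : ℤ → ℂ}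
    (hA : ∀ i j, A i j = a ((i : ℤ) - (j : ℤ))) (i : Fin ν) (j : Fin μ) :
    A.conjTranspose i j = star (a (-((i : ℤ) - (j : ℤ)))) := by
  rw [Matrix.conjTranspose_apply, hA, neg_sub]

theorem conj_circGen (N n m : ℕ) (a : ℤ → ℂ) :
    (fun k => starRingEnd ℂ (circGen N n (truncSymbol 0 m fun d => a (-d)) k)) =
      circGen N n (truncSymbol 0 m fun d => star (a (-d))) := by
  funext k
  simp only [circGen, truncSymbol, apply_ite (starRingEnd ℂ), map_zero]
  rfl

theorem interpModule_three {N r : ℕ} (σ : Fin N → ℂ) (F G H : Fin r → Fin N → ℂ) :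
    interpModule (fun c : Fin N × Fin 3 => σ c.1)
      (fun c => (![fun j => F j c.1, fun j => G j c.1, fun j => H j c.1] : Fin 3 → Fin r → ℂ) c.2) =
    interpModule σ (fun k j => F j k) ⊓ interpModule σ (fun k j => G j k) ⊓
      interpModule σ (fun k j => H j k) := by
  ext p
  refine ⟨fun h => ⟨⟨fun k => h (k, 0), fun k => h (k, 1)⟩, fun k => h (k, 2)⟩, ?_⟩
  rintro ⟨⟨h0, h1⟩, h2⟩ ⟨k, t⟩
  fin_cases t
  exacts [h0 k, h1 k, h2 k]

theorem interpModule_two {N r : ℕ} (σ : Fin N → ℂ) (F G : Fin r → Fin N → ℂ) :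
    interpModule (fun c : Fin N × Fin 2 => σ c.1)
      (fun c => (![fun j => F j c.1, fun j => G j c.1] : Fin 2 → Fin r → ℂ) c.2) =
    interpModule σ (fun k j => F j k) ⊓ interpModule σ (fun k j => G j k) := by
  ext p
  refine ⟨fun h => ⟨fun k => h (k, 0), fun k => h (k, 1)⟩, ?_⟩
  rintro ⟨h0, h1⟩ ⟨k, t⟩
  fin_cases t
  exacts [h0 k, h1 k]

/-- Equal lengths let the three rows share their nodes, giving three conditions at each, the maximum
that `basisAtRoots` is proved for. -/
theorem isReducedOutput_generalBasis {m n p : ℕ} {T : Matrix (Fin m) (Fin n) ℂ} (hm : 0 < m)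
    (a l : ℤ → ℂ) (b : Fin m → ℂ) (hT : ∀ i j, T i j = a ((i : ℤ) - (j : ℤ))) :
    IsReducedOutput
      (generalModule m n p (2 ^ sizeExp (max m p) n) (2 ^ sizeExp (max m p) n)
        (2 ^ sizeExp (max m p) n)
        (truncSymbol 0 m fun d => star (a (-d))) (truncSymbol 0 p fun d => star (l (-d)))
        (truncSymbol 0 n a) (truncSymbol 0 n l) (T.conjTranspose.mulVec b))
      (generalTau m n p (2 ^ sizeExp (max m p) n) (2 ^ sizeExp (max m p) n)
        (2 ^ sizeExp (max m p) n)) (generalBasis m n p a l b).run := by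
  have hle := le_two_pow_sizeExp (max m p) n
  have hy : (fun i : Fin n => cyc (circGen (2 ^ sizeExp (max m p) n) n
      (truncSymbol 0 m fun d => star (a (-d)))) (toPoly b)
        ⟨2 ^ sizeExp (max m p) n - n + i, by omega⟩) = T.conjTranspose.mulVec b := by
    funext i
    rw [cyc_circGen (eq_truncSymbol (conjTranspose_eq_symbol hT)) hm (by omega)
      (toPoly_mem_degLE b), coeff_toPoly_fin]
  simp only [generalBasis, run_bind, run_constP, run_rootConst, run_tab, run_conjP, conj_circGen,
    run_negP, run_convBottom (show n ≤ 2 ^ sizeExp (max m p) n by omega)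
      (show m ≤ 2 ^ sizeExp (max m p) n by omega), hy, run_transformRow]
  have h := isReducedOutput_basisAtRoots le_rfl (sizeExp (max m p) n)
    (generalTau m n p (2 ^ sizeExp (max m p) n) (2 ^ sizeExp (max m p) n)
      (2 ^ sizeExp (max m p) n)) fun k => ![
    fun j => (fourier (2 ^ sizeExp (max m p) n)).mulVec (generalRow₁ (2 ^ sizeExp (max m p) n) 0 1
      (circGen _ n (truncSymbol 0 m fun d => star (a (-d))))
      (circGen _ n (truncSymbol 0 p fun d => star (l (-d))))
      (bottom _ 0 (-(T.conjTranspose.mulVec b))) j) k,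
    fun j => (fourier (2 ^ sizeExp (max m p) n)).mulVec (generalRow₂ (2 ^ sizeExp (max m p) n) m 0 1
      (-circGen _ m (truncSymbol 0 n a)) j) k,
    fun j => (fourier (2 ^ sizeExp (max m p) n)).mulVec (generalRow₃ (2 ^ sizeExp (max m p) n) p 0 1
      (-circGen _ p (truncSymbol 0 n l)) j) k]
  rw [interpModule_three (node _) (fun j => (fourier _).mulVec _) (fun j => (fourier _).mulVec _)
    fun j => (fourier _).mulVec _] at h
  exact h

theorem isReducedOutput_gramBasis (n p : ℕ) (g l : ℤ → ℂ) (y : Fin n → ℂ) :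
    IsReducedOutput
      (gramModule n p (2 ^ sizeExp (max n p) n) (2 ^ sizeExp (max n p) n)
        (truncSymbol 0 n g) (truncSymbol 0 p fun d => star (l (-d))) (truncSymbol 0 n l) y)
      (gramTau n p (2 ^ sizeExp (max n p) n) (2 ^ sizeExp (max n p) n))
      (gramBasis n p g l y).run := by
  simp only [gramBasis, run_bind, run_constP, run_rootConst, run_tab, run_conjP, conj_circGen,
    run_negP, run_transformRow]
  have h := isReducedOutput_basisAtRoots (by norm_num) (sizeExp (max n p) n)
    (gramTau n p (2 ^ sizeExp (max n p) n) (2 ^ sizeExp (max n p) n)) fun k => ![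
    fun j => (fourier (2 ^ sizeExp (max n p) n)).mulVec (gramRow₁ (2 ^ sizeExp (max n p) n) 0 1
      (circGen _ n (truncSymbol 0 n g))
      (circGen _ n (truncSymbol 0 p fun d => star (l (-d)))) (bottom _ 0 (-y)) j) k,
    fun j => (fourier (2 ^ sizeExp (max n p) n)).mulVec (gramRow₂ (2 ^ sizeExp (max n p) n) p 0 1
      (-circGen _ p (truncSymbol 0 n l)) j) k]
  rw [interpModule_two (node _) (fun j => (fourier _).mulVec _) fun j => (fourier _).mulVec _] at h
  exact h

theorem run_zeroColumn {r : ℕ} {τ : Fin r → ℤ} {l : List (Fin r)} (h : ∃ j ∈ l, τ j = 0) :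
    ∃ j, (zeroColumn τ l : Prog ℂ _).run = some j ∧ τ j = 0 := by
  induction l with
  | nil => simp at h
  | cons i l ih =>
    by_cases hi : τ i = 0
    · exact ⟨i, by simp [zeroColumn, hi], hi⟩
    · obtain ⟨j, hj, hj0⟩ := h
      rcases List.mem_cons.mp hj with rfl | hj
      · exact absurd hj0 hi
      · obtain ⟨j', h1, h2⟩ := ih ⟨j, hj, hj0⟩
        exact ⟨j', by simpa [zeroColumn, hi] using h1, h2⟩

theorem cost_zeroColumn_le {r : ℕ} (τ : Fin r → ℤ) (l : List (Fin r)) :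
    (zeroColumn τ l : Prog ℂ _).cost ≤ l.length := by
  induction l with
  | nil => simp [zeroColumn]
  | cons i l ih =>
    rw [zeroColumn]
    refine (cost_bind_le (b := l.length) (cost_compareP _).le fun y => ?_).trans
      (by rw [List.length_cons, add_comm])
    cases y
    · exact ih
    · simp

theorem padVec_eq_coeff_toPoly {d d' : ℕ} (v : Fin d → ℂ) (i : Fin d') :
    padVec d' 0 v i = (toPoly v).coeff i := by
  rw [coeff_toPoly, padVec]

theorem run_readOff {r d n : ℕ} {S : Submodule ℂ[X] (Fin (r + 1) → ℂ[X])} {τ : Fin (r + 1) → ℤ}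
    {x : Fin n → ℂ} {st : PolyMat ℂ (r + 1) d × (Fin (r + 1) → ℤ)}
    (hst : IsReducedOutput S τ st) (hx : ReadOffBases S τ x) : (readOff n st).run = x := by
  obtain ⟨j, hj0, hj1, β, hβ, hlast, hxβ⟩ := hx.2.2 _ hst.1
  have hτj : st.2 j = 0 := by
    rw [hst.2 j] at hj0
    have : (-st.2 j : ℤ) = 0 := by exact_mod_cast hj0
    omega
  obtain ⟨j', hrun, hj'⟩ := run_zeroColumn (l := List.finRange (r + 1))
    ⟨j, List.mem_finRange j, hτj⟩
  -- The search may meet another column first, but all others have τ-degree 1.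
  have hjj : j' = j := by
    by_contra hne
    have h1 := hj1 j' hne
    rw [hst.2 j', hj'] at h1
    have : (-0 : ℤ) = 1 := by exact_mod_cast h1
    omega
  subst hjj
  funext i
  have hc := congrArg (fun f => f.coeff (i : ℕ)) hxβ
  simp only [coeff_C_mul] at hc
  have hxi : (toPoly x).coeff i = x i := congrFun (coeff_toPoly_fin x) i
  have h0 : (toPoly (st.1 (Fin.last r) j')).coeff 0 = β := by
    have : toPoly (st.1 (Fin.last r) j') = C β := hlast
    rw [this, coeff_C_zero]
  simp only [readOff, run_bind, run_constP, hrun, run_tab, run_divP, padVec_eq_coeff_toPoly]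
  rw [Fin.val_zero, h0, ← hxi, hc, div_eq_inv_mul]
  rfl

theorem cost_readOff_le {r d : ℕ} (n : ℕ) (st : PolyMat ℂ (r + 1) d × (Fin (r + 1) → ℤ)) :
    (readOff n st).cost ≤ r + 2 + n := by
  rw [readOff]
  refine (cost_bind_le (cost_constP _).le fun _ => cost_bind_le (b := n)
    (cost_zeroColumn_le _ _) fun j? => ?_).trans (by rw [List.length_finRange]; omega)
  cases j? with
  | none => simp
  | some j => exact (cost_tab_le (c := 1) fun _ => by simp).trans (by simp)

/-! ### Operation counts of the solvers -/

theorem cost_transformRow_le {r : ℕ} (e : ℕ) (ω : ℂ) (c : Fin r → Fin (2 ^ e) → ℂ) :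
    (transformRow e ω c).cost ≤ r * (4 * e * 2 ^ e) :=
  cost_tab_le fun _ => cost_fft_le _ _ _

theorem cost_negP_le {d : ℕ} (z : ℂ) (v : Fin d → ℂ) : (negP z v).cost ≤ d * 1 :=
  cost_tab_le fun _ => by simp

/-- The 21 transforms and the convolution cost at most (96e + 5)2^e; the generous 200 also absorbs
all linear and constant terms. -/
theorem cost_generalSolver_le (m n p : ℕ) (a l : ℤ → ℂ) (b : Fin m → ℂ) :
    (generalSolver m n p a l b).cost ≤ (200 + recBound 7) *
      ((sizeExp (max m p) n + 1) ^ 2 * 2 ^ sizeExp (max m p) n) := by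
  have hn : n ≤ 2 ^ sizeExp (max m p) n :=
    (Nat.le_add_left _ _).trans (le_two_pow_sizeExp (max m p) n)
  rw [generalSolver, generalBasis]
  refine (cost_bind_le (cost_bind_le (cost_constP _).le fun _ => cost_bind_le (cost_constP _).le
    fun _ => cost_bind_le (cost_rootConst _).le fun _ =>
    cost_bind_le (cost_tab_le (c := 1) fun _ => by simp) fun _ =>
    cost_bind_le (cost_tab_le (c := 1) fun _ => by simp) fun _ =>
    cost_bind_le (cost_negP_le _ _) fun _ => cost_bind_le (cost_negP_le _ _) fun _ =>
    cost_bind_le (cost_convBottom_le _ _ _ _ _ _) fun _ => cost_bind_le (cost_negP_le _ _) fun _ =>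
    cost_bind_le (cost_transformRow_le _ _ _) fun _ =>
    cost_bind_le (cost_transformRow_le _ _ _) fun _ =>
    cost_bind_le (cost_transformRow_le _ _ _) fun _ =>
    cost_basisAtRoots_le le_rfl _ _ _) fun _ => cost_readOff_le _ _).trans ?_
  have h1 : 1 ≤ 2 ^ sizeExp (max m p) n := Nat.one_le_two_pow
  generalize sizeExp (max m p) n = e at *
  generalize 2 ^ e = P at *
  nlinarith [Nat.zero_le (e * P), Nat.zero_le (e ^ 2 * P)]

theorem cost_gramSolver_le (n p : ℕ) (g l : ℤ → ℂ) (y : Fin n → ℂ) :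
    (gramSolver n p g l y).cost ≤ (200 + recBound 5) *
      ((sizeExp (max n p) n + 1) ^ 2 * 2 ^ sizeExp (max n p) n) := by
  have hn : n ≤ 2 ^ sizeExp (max n p) n :=
    (Nat.le_add_left _ _).trans (le_two_pow_sizeExp (max n p) n)
  rw [gramSolver, gramBasis]
  refine (cost_bind_le (cost_bind_le (cost_constP _).le fun _ => cost_bind_le (cost_constP _).le
    fun _ => cost_bind_le (cost_rootConst _).le fun _ =>
    cost_bind_le (cost_tab_le (c := 1) fun _ => by simp) fun _ =>
    cost_bind_le (cost_negP_le _ _) fun _ => cost_bind_le (cost_negP_le _ _) fun _ =>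
    cost_bind_le (cost_transformRow_le _ _ _) fun _ =>
    cost_bind_le (cost_transformRow_le _ _ _) fun _ =>
    cost_basisAtRoots_le (by norm_num) _ _ _) fun _ => cost_readOff_le _ _).trans ?_
  have h1 : 1 ≤ 2 ^ sizeExp (max n p) n := Nat.one_le_two_pow
  generalize sizeExp (max n p) n = e at *
  generalize 2 ^ e = P at *
  nlinarith [Nat.zero_le (e * P), Nat.zero_le (e ^ 2 * P)]

/-- From e log 2 ≤ log 2M ≤ 2 log M and e + 1 ≤ 2e; the constant is 4 · 2 · 4 = 32. -/
theorem sq_mul_two_pow_le {e M : ℕ} (he : 1 ≤ e) (hM : 2 ≤ M) (h : 2 ^ e ≤ 2 * M) :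
    (((e + 1) ^ 2 * 2 ^ e : ℕ) : ℝ) ≤ 32 / Real.log 2 ^ 2 * (M * Real.log M ^ 2) := by
  have h2 : 0 < Real.log 2 := Real.log_pos (by norm_num)
  have hM' : (2 : ℝ) ≤ M := by exact_mod_cast hM
  have he' : (1 : ℝ) ≤ e := by exact_mod_cast he
  have hpow : (2 : ℝ) ^ e ≤ 2 * M := by exact_mod_cast h
  have hlog : e * Real.log 2 ≤ 2 * Real.log M := by
    have h3 := Real.log_le_log (by positivity) hpow
    rw [Real.log_pow, Real.log_mul (by norm_num) (by positivity)] at h3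
    have h4 := Real.log_le_log (by norm_num) hM'
    linarith
  have hsq : (e * Real.log 2) ^ 2 ≤ (2 * Real.log M) ^ 2 := by gcongr
  have h5 : ((e : ℝ) + 1) ^ 2 ≤ 4 * e ^ 2 := by nlinarith
  rw [div_mul_eq_mul_div, le_div_iff₀ (by positivity)]
  push_cast
  calc ((e : ℝ) + 1) ^ 2 * 2 ^ e * Real.log 2 ^ 2 ≤ 4 * e ^ 2 * (2 * M) * Real.log 2 ^ 2 := by
        gcongr
    _ = 8 * M * (e * Real.log 2) ^ 2 := by ring
    _ ≤ 8 * M * (2 * Real.log M) ^ 2 := by gcongr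
    _ = 32 * (M * Real.log M ^ 2) := by ring

/-- Minimality of the exponent gives 2^e < 2(q + n) ≤ 2M. -/
theorem cost_le_of_sizeExp {c K q n M : ℕ} (hq : 0 < q) (hn : 0 < n) (hM : q + n ≤ M)
    (hc : c ≤ K * ((sizeExp q n + 1) ^ 2 * 2 ^ sizeExp q n)) :
    (c : ℝ) ≤ K * (32 / Real.log 2 ^ 2) * M * Real.log M ^ 2 := by
  have he : 1 ≤ sizeExp q n := Nat.clog_pos (by norm_num) (by omega)
  have hlt : 2 ^ (sizeExp q n - 1) < q + n := Nat.pow_pred_clog_lt_self (by norm_num) (by omega)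
  have hpow : 2 ^ sizeExp q n = 2 * 2 ^ (sizeExp q n - 1) := by
    rw [← pow_succ', Nat.sub_add_cancel he]
  have h1 := sq_mul_two_pow_le he (M := M) (by omega) (by omega)
  have h2 : (c : ℝ) ≤ K * (((sizeExp q n + 1) ^ 2 * 2 ^ sizeExp q n : ℕ) : ℝ) := by
    exact_mod_cast hc
  refine h2.trans ((mul_le_mul_of_nonneg_left h1 (Nat.cast_nonneg K)).trans (le_of_eq ?_))
  ring

end Tikhonov

end

open Polynomial Tikhonov in
theorem mainTheorem1 :
    -- the recursive interleaved construction
    (∀ r : ℕ, ∃ K : ℝ, ∀ (s e : ℕ) (τ : Fin r → ℤ) (φ : Fin (2 ^ e) → Fin s → Fin r → ℂ),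
      s ≤ 3 →
      IsReducedOutput
          (interpModule (fun c : Fin (2 ^ e) × Fin s => node (2 ^ e) c.1) fun c => φ c.1 c.2) τ
          (basisAtRoots e τ φ).run ∧
        (1 ≤ e → ((basisAtRoots e τ φ).cost : ℝ) ≤
          K * (2 ^ e : ℕ) * Real.log (2 ^ e : ℕ) ^ 2)) ∧
    -- `T` and `L` Toeplitz
    (∃ K : ℝ, ∀ (m n p : ℕ) (T : Matrix (Fin m) (Fin n) ℂ) (L : Matrix (Fin p) (Fin n) ℂ)
        (b : Fin m → ℂ), 0 < m → 0 < n → 0 < p →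
      IsUnit (T.conjTranspose * T + L.conjTranspose * L) →
      ∀ a l : ℤ → ℂ, (∀ i j, T i j = a ((i : ℤ) - (j : ℤ))) →
        (∀ i j, L i j = l ((i : ℤ) - (j : ℤ))) →
      -- the interpolation problem, for all circulant extensions
      (∀ (aH lH : ℤ → ℂ) (N₁ N₂ N₃ : ℕ),
        (∀ i j, T.conjTranspose i j = aH ((i : ℤ) - (j : ℤ))) →
        (∀ i j, L.conjTranspose i j = lH ((i : ℤ) - (j : ℤ))) →
        max m p + n - 1 ≤ N₁ → m + n - 1 ≤ N₂ → p + n - 1 ≤ N₃ →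
        let S := generalModule m n p N₁ N₂ N₃ aH lH a l (T.conjTranspose.mulVec b)
        let τ := generalTau m n p N₁ N₂ N₃
        (∃ q ∈ S, q 0 = toPoly (tikhonovSolution T L b) ∧
          q 1 = toPoly (T.mulVec (tikhonovSolution T L b)) ∧
          q 2 = toPoly (L.mulVec (tikhonovSolution T L b)) ∧ q 6 = 1 ∧ tauDeg τ q = 0 ∧
          ∀ f ∈ S, tauDeg τ f ≤ 0 ↔ ∃ α : ℂ, f = (C α : ℂ[X]) • q) ∧
        ReadOffBases S τ (tikhonovSolution T L b)) ∧
      -- the algorithm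
      (let N := 2 ^ sizeExp (max m p) n
       IsReducedOutput
          (generalModule m n p N N N
            (truncSymbol 0 m fun d => star (a (-d))) (truncSymbol 0 p fun d => star (l (-d)))
            (truncSymbol 0 n a) (truncSymbol 0 n l) (T.conjTranspose.mulVec b))
          (generalTau m n p N N N) (generalBasis m n p a l b).run) ∧
      (generalSolver m n p a l b).run = tikhonovSolution T L b ∧
      ((generalSolver m n p a l b).cost : ℝ) ≤
        K * ((m + n - 1) + (p + n - 1) : ℕ) * Real.log ((m + n - 1) + (p + n - 1) : ℕ) ^ 2) ∧
    -- `TᴴT` and `L` Toeplitz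
    (∃ K : ℝ, ∀ (m n p : ℕ) (T : Matrix (Fin m) (Fin n) ℂ) (L : Matrix (Fin p) (Fin n) ℂ)
        (b : Fin m → ℂ), 0 < n → 0 < p →
      IsUnit (T.conjTranspose * T + L.conjTranspose * L) →
      ∀ g l : ℤ → ℂ, (∀ i j, (T.conjTranspose * T) i j = g ((i : ℤ) - (j : ℤ))) →
        (∀ i j, L i j = l ((i : ℤ) - (j : ℤ))) →
      -- the interpolation problem, for all circulant extensions
      (∀ (lH : ℤ → ℂ) (N₁ N₂ : ℕ),
        (∀ i j, L.conjTranspose i j = lH ((i : ℤ) - (j : ℤ))) →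
        max n p + n - 1 ≤ N₁ → p + n - 1 ≤ N₂ →
        let S := gramModule n p N₁ N₂ g lH l (T.conjTranspose.mulVec b)
        let τ := gramTau n p N₁ N₂
        (∃ q ∈ S, q 0 = toPoly (tikhonovSolution T L b) ∧
          q 1 = toPoly (L.mulVec (tikhonovSolution T L b)) ∧ q 4 = 1 ∧ tauDeg τ q = 0 ∧
          ∀ f ∈ S, tauDeg τ f ≤ 0 ↔ ∃ α : ℂ, f = (C α : ℂ[X]) • q) ∧
        ReadOffBases S τ (tikhonovSolution T L b)) ∧
      -- the algorithm, which is given `Tᴴb`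
      (let N := 2 ^ sizeExp (max n p) n
       IsReducedOutput
          (gramModule n p N N (truncSymbol 0 n g) (truncSymbol 0 p fun d => star (l (-d)))
            (truncSymbol 0 n l) (T.conjTranspose.mulVec b))
          (gramTau n p N N) (gramBasis n p g l (T.conjTranspose.mulVec b)).run) ∧
      (gramSolver n p g l (T.conjTranspose.mulVec b)).run = tikhonovSolution T L b ∧
      ((gramSolver n p g l (T.conjTranspose.mulVec b)).cost : ℝ) ≤
        K * (n + (p + n - 1) : ℕ) * Real.log (n + (p + n - 1) : ℕ) ^ 2) := by
  refine ⟨fun r => ⟨(2 + recBound r : ℕ) * (32 / Real.log 2 ^ 2), fun s e τ φ hs =>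
    ⟨isReducedOutput_basisAtRoots hs e τ φ, fun he => ?_⟩⟩,
    ⟨(200 + recBound 7 : ℕ) * (32 / Real.log 2 ^ 2), ?_⟩,
    ⟨(200 + recBound 5 : ℕ) * (32 / Real.log 2 ^ 2), ?_⟩⟩
  · have h2 : 2 ≤ 2 ^ e := Nat.le_self_pow (by omega) 2
    have hone : 1 ≤ (e + 1) ^ 2 * 2 ^ e := Nat.one_le_iff_ne_zero.mpr (by positivity)
    have h1 : (basisAtRoots e τ φ).cost ≤ (2 + recBound r) * ((e + 1) ^ 2 * 2 ^ e) := by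
      refine (cost_basisAtRoots_le hs e τ φ).trans ?_
      rw [add_mul, ← mul_assoc (recBound r)]
      omega
    have h3 : ((basisAtRoots e τ φ).cost : ℝ) ≤
        (2 + recBound r : ℕ) * (((e + 1) ^ 2 * 2 ^ e : ℕ) : ℝ) := by exact_mod_cast h1
    refine h3.trans ((mul_le_mul_of_nonneg_left (sq_mul_two_pow_le he h2 (by omega))
      (Nat.cast_nonneg _)).trans (le_of_eq ?_))
    ring
  · intro m n p T L b hm hn hp hunit a l hT hL
    have hle := le_two_pow_sizeExp (max m p) n
    have hout := isReducedOutput_generalBasis (p := p) hm a l b hT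
    refine ⟨fun aH lH N₁ N₂ N₃ hTH hLH h₁ h₂ h₃ =>
      ⟨generalModule_solution hm hn hp hT hL hTH hLH h₁ h₂ h₃ b hunit,
        readOffBases_generalModule hm hn hp hT hL hTH hLH h₁ h₂ h₃ b hunit⟩, hout, ?_,
      -- As all sizes are positive, there are at least max m p + n free parameters.
      cost_le_of_sizeExp (by omega) hn (by omega) (cost_generalSolver_le m n p a l b)⟩
    rw [generalSolver, Prog.run_bind]
    -- The zero-filled extensions are among the circulant extensions already treated, with all three
    -- lengths equal to the power of two.
    exact run_readOff hout (readOffBases_generalModule hm hn hp (eq_truncSymbol hT)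
      (eq_truncSymbol hL) (eq_truncSymbol (conjTranspose_eq_symbol hT))
      (eq_truncSymbol (conjTranspose_eq_symbol hL)) (by omega) (by omega) (by omega) b hunit)
  · intro m n p T L b hn hp hunit g l hG hL
    have hle := le_two_pow_sizeExp (max n p) n
    have hout := isReducedOutput_gramBasis n p g l (T.conjTranspose.mulVec b)
    refine ⟨fun lH N₁ N₂ hLH h₁ h₂ =>
      ⟨gramModule_solution hn hp hG hL hLH h₁ h₂ b hunit,
        readOffBases_gramModule hn hp hG hL hLH h₁ h₂ b hunit⟩, hout, ?_,
      cost_le_of_sizeExp (by omega) hn (by omega) (cost_gramSolver_le n p g l _)⟩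
    rw [gramSolver, Prog.run_bind]
    exact run_readOff hout (readOffBases_gramModule hn hp (eq_truncSymbol hG) (eq_truncSymbol hL)
      (eq_truncSymbol (conjTranspose_eq_symbol hL)) (by omega) (by omega) b hunit)
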